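/- Let $j=n/2$ with $n\ge 1$ an integer, let $\mathcal H_j$ be the spin-$j$ space with orthonormal basis $|j;m\rangle$, $m=-j,-j+1,\dots,j$, and angular momentum operators $J_1,J_2,J_3$. For $a\in\{-j,-j+1,\dots,j\}$ consider the probe $\rho=|n/2;a\rangle\langle n/2;a|$ and the state family $\rho_\theta=U_\theta\rho U_\theta^\dagger$, $U_\theta=\exp(i(\theta_1J_1+\theta_2J_2))$, $\theta\in\Theta=\{|\theta|\le\pi\}$ (identified with $\mathrm{SU}(2)/\mathrm U(1)$, the points of the boundary circle representing one coset). Let $R(\theta,\hat\theta)=|\langle\frac12;\frac12|U_\theta^\dagger U_{\hat\theta}|\frac12;\frac12\rangle|^2$ (with $U_\theta$ acting on spin $\frac12$) and, for a POVM $M$ on $\mathcal H_j$ with outcomes in $\Theta$, let $$R(M)=\min_{\theta\in\Theta}\int_\Theta R(\theta,\hat\theta)\,\mathrm{Tr}\,\rho_\theta M(d\hat\theta),\qquad \eta(M)=4(1-R(M)).$$ Let $P_{j\pm1/2}$ be the projections onto the total-spin-$(j\pm\frac12)$ subspaces of $\mathcal H_{1/2}\otimes\mathcal H_j$. Let (BFY)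 be the condition $$\tfrac{1}{2j+2}\mathrm{Tr}\,P_{j+1/2}\big(|\tfrac12;\tfrac12\rangle\langle\tfrac12;\tfrac12|\otimes\rho\big)\ \ge\ \tfrac1{2j}\mathrm{Tr}\,P_{j-1/2}\big(|\tfrac12;\tfrac12\rangle\langle\tfrac12;\tfrac12|\otimes\rho\big).$$ Let $F$ be the SLD Fisher information matrix of $\{\rho_\theta\}$ at $\theta=0$, i.e. $F_{ij}=\frac12\mathrm{Tr}\,L_i(L_j\rho+\rho L_j)$ for any Hermitian $L_i$ with $\partial_i\rho_\theta|_{\theta=0}=\frac12(L_i\rho+\rho L_i)$. Let $C_0[I]$ be the tight Cramér–Rao bound, i.e. the infimum of the trace of the mean-square-error matrix at $\theta=0$ over all estimators with finitely many outcomes that are locally unbiased at $\theta=0$. Then: 1. (BFY) holds if and only if $a\ge0$. 2. If $a\ge 0$, the maximum of $R(M)$ over all POVMs exists and equals $\dfrac{n/2+a+1}{n+2}$. As $n\to\infty$, the difference between this maximum and $\frac12+\frac an$ tends to $0$, uniformly in $a\ge0$. For every $c<\frac12$ there is $\delta>0$ such that $\eta(M)\ge\delta$ for all $n\ge 1$,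 all $a$ with $0\le a\le cn$ and all POVMs $M$. 3. SLDs exist, $F$ does not depend on their choice, and $F_{11}=F_{22}=2(j^2-a^2)+2j$, $F_{12}=F_{21}=0$. For every $c<\frac12$ there is a constant $K$ with $C_0[I]\le K/n^2$ for all $n\ge 1$ and all $a$ with $|a|\le cn$. If $a/n\to\alpha$ with $|\alpha|<\frac12$, then the SLD bound satisfies $n^2\,\mathrm{Tr}\,F^{-1}\to(\frac14-\alpha^2)^{-1}$. 4. For the half-Dicke state ($n$ even, $a=0$), $F_{11}=F_{22}=2j(j+1)=\frac12n(n+2)$, $F_{12}=F_{21}=0$ and $C_0[I]=O(1/n^2)$, while the maximum of $R(M)$ is $\frac12$ and the minimum of $\eta(M)$ is $2$ for every such $n$; so Heisenberg scaling is lost in global estimation. -/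

import Mathlib

open MeasureTheory Filter Topology
open scoped Matrix Kronecker ENNReal ComplexOrder

namespace SpinEstimation

noncomputable section

/-! ### Spin `j = n/2` systems

The spin-`n/2` space is `ℂ^(n+1)`, with orthonormal basis indexed by `k : Fin (n+1)`; the index `k`
stands for the vector `|j; m⟩` with `m = k - n/2`. In particular, for `n = 1` the index `1` stands
for `|1/2; 1/2⟩` and the index `0` for `|1/2; -1/2⟩`. -/

/-- The magnetic quantum number `m = k - j`, where `j = n/2`. -/
def wt (n : ℕ) (k : Fin (n + 1)) : ℝ := (k : ℝ) - (n : ℝ) / 2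

/-- The raising operator: `J₊ |j;m⟩ = √((j-m)(j+m+1)) |j;m+1⟩`. -/
def Jplus (n : ℕ) : Matrix (Fin (n + 1)) (Fin (n + 1)) ℂ :=
  Matrix.of fun r s =>
    if (r : ℕ) = (s : ℕ) + 1 then
      ((Real.sqrt (((n : ℝ) / 2 - wt n s) * ((n : ℝ) / 2 + wt n s + 1)) : ℝ) : ℂ)
    else 0

/-- The lowering operator, the adjoint of the raising operator. -/
def Jminus (n : ℕ) : Matrix (Fin (n + 1)) (Fin (n + 1)) ℂ := (Jplus n)ᴴ

/-- `J₁ = (J₊ + J₋)/2`. -/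
def J1 (n : ℕ) : Matrix (Fin (n + 1)) (Fin (n + 1)) ℂ :=
  (1 / 2 : ℂ) • (Jplus n + Jminus n)

/-- `J₂ = (J₊ - J₋)/(2i)`. -/
def J2 (n : ℕ) : Matrix (Fin (n + 1)) (Fin (n + 1)) ℂ :=
  (1 / (2 * Complex.I) : ℂ) • (Jplus n - Jminus n)

/-- `J₃ = ∑ m |j;m⟩⟨j;m|`. -/
def J3 (n : ℕ) : Matrix (Fin (n + 1)) (Fin (n + 1)) ℂ :=
  Matrix.diagonal fun k => ((wt n k : ℝ) : ℂ)

/-- The probe state `|n/2; a⟩⟨n/2; a|` with `a = k - n/2`. -/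
def dicke (n : ℕ) (k : Fin (n + 1)) : Matrix (Fin (n + 1)) (Fin (n + 1)) ℂ :=
  Matrix.single k k 1

/-- `U_θ = exp(i(θ₁ J₁ + θ₂ J₂))` on the spin-`n/2` space. -/
def rot (n : ℕ) (θ : EuclideanSpace ℝ (Fin 2)) : Matrix (Fin (n + 1)) (Fin (n + 1)) ℂ :=
  NormedSpace.exp (Complex.I • (((θ 0 : ℝ) : ℂ) • J1 n + ((θ 1 : ℝ) : ℂ) • J2 n))

/-- The unitary state family `ρ_θ = U_θ ρ U_θ†` generated by the probe `ρ`. -/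
def model (n : ℕ) (ρ : Matrix (Fin (n + 1)) (Fin (n + 1)) ℂ) (θ : EuclideanSpace ℝ (Fin 2)) :
    Matrix (Fin (n + 1)) (Fin (n + 1)) ℂ :=
  rot n θ * ρ * (rot n θ)ᴴ

theorem dicke_posSemidef (n : ℕ) (k : Fin (n + 1)) : (dicke n k).PosSemidef := by
  have h : dicke n k = Matrix.diagonal (Pi.single k (1 : ℂ)) := by
    ext r s
    by_cases hrs : r = s
    · subst hrs
      by_cases hk : k = r
      · subst hk; simp [dicke]
      · simp [dicke, Matrix.single, hk, Ne.symm hk]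
    · rw [Matrix.diagonal_apply_ne _ hrs]
      by_cases hk : k = r
      · subst hk; simp [dicke, Matrix.single, hrs]
      · simp [dicke, Matrix.single, hk]
  rw [h]
  refine Matrix.PosSemidef.diagonal fun i => ?_
  by_cases hi : i = k
  · subst hi; simp
  · simp [hi]

theorem model_posSemidef (n : ℕ) {ρ : Matrix (Fin (n + 1)) (Fin (n + 1)) ℂ} (hρ : ρ.PosSemidef)
    (θ : EuclideanSpace ℝ (Fin 2)) : (model n ρ θ).PosSemidef :=
  hρ.mul_mul_conjTranspose_same _

/-! ### Addition of a spin 1/2: the spaces `H_{j ± 1/2}` inside `H_{1/2} ⊗ H_j` -/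

/-- The Casimir operator `∑ᵢ (Jᵢ ⊗ 1 + 1 ⊗ Jᵢ)²` of `SU(2)` on `H_{1/2} ⊗ H_j`. -/
def totalCasimir (n : ℕ) :
    Matrix (Fin (1 + 1) × Fin (n + 1)) (Fin (1 + 1) × Fin (n + 1)) ℂ :=
  (J1 1 ⊗ₖ 1 + 1 ⊗ₖ J1 n) ^ 2 + (J2 1 ⊗ₖ 1 + 1 ⊗ₖ J2 n) ^ 2 + (J3 1 ⊗ₖ 1 + 1 ⊗ₖ J3 n) ^ 2

/-- The subspace of total spin `s` of `H_{1/2} ⊗ H_j`: the eigenspace of the Casimir operator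
for the eigenvalue `s (s + 1)`. -/
def totalSpinSpace (n : ℕ) (s : ℝ) :
    Submodule ℂ (EuclideanSpace ℂ (Fin (1 + 1) × Fin (n + 1))) :=
  Module.End.eigenspace (Matrix.toEuclideanLin (totalCasimir n)) ((s * (s + 1) : ℝ) : ℂ)

/-- The matrix of the orthogonal projection onto the subspace of total spin `s`. -/
def totalSpinProj (n : ℕ) (s : ℝ) :
    Matrix (Fin (1 + 1) × Fin (n + 1)) (Fin (1 + 1) × Fin (n + 1)) ℂ :=
  Matrix.toEuclideanLin.symm (totalSpinSpace n s).starProjection.toLinearMap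

/-- The weight `Tr P_s (|1/2;1/2⟩⟨1/2;1/2| ⊗ ρ)`. -/
def spinWeight (n : ℕ) (ρ : Matrix (Fin (n + 1)) (Fin (n + 1)) ℂ) (s : ℝ) : ℝ :=
  (Matrix.trace (totalSpinProj n s * (dicke 1 1 ⊗ₖ ρ))).re

/-- The condition
`(1/(2j+2)) Tr P_{j+1/2} (|1/2;1/2⟩⟨1/2;1/2| ⊗ ρ) ≥ (1/(2j)) Tr P_{j-1/2} (|1/2;1/2⟩⟨1/2;1/2| ⊗ ρ)`
with `2j = n`. -/
def BFY (n : ℕ) (ρ : Matrix (Fin (n + 1)) (Fin (n + 1)) ℂ) : Prop :=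
  1 / ((n : ℝ) + 2) * spinWeight n ρ ((n : ℝ) / 2 + 1 / 2) ≥
    1 / (n : ℝ) * spinWeight n ρ ((n : ℝ) / 2 - 1 / 2)

/-! ### Measurements and global estimation -/

/-- A positive operator valued measure on `X` acting on `ℂ^ι`. -/
structure POVM (X : Type*) [MeasurableSpace X] (ι : Type*) [Fintype ι] [DecidableEq ι] where
  toVectorMeasure : VectorMeasure X (Matrix ι ι ℂ)
  posSemidef : ∀ B, (toVectorMeasure B).PosSemidef
  total : toVectorMeasure Set.univ = 1

open scoped MatrixOrder Matrix.Norms.L2Operator in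
theorem trace_mul_re_nonneg {ι : Type*} [Fintype ι] [DecidableEq ι] {A B : Matrix ι ι ℂ}
    (hA : A.PosSemidef) (hB : B.PosSemidef) : 0 ≤ (Matrix.trace (A * B)).re := by
  obtain ⟨C, rfl⟩ := CStarAlgebra.nonneg_iff_eq_star_mul_self.mp hA.nonneg
  rw [Matrix.mul_assoc, Matrix.trace_mul_comm]
  exact (Complex.nonneg_iff.mp (hB.mul_mul_conjTranspose_same C).trace_nonneg).1

/-- The distribution `B ↦ Tr ρ M(B)` of the outcome when the measurement `M` is applied to the
state `ρ`. -/
def outcomeLaw {X : Type*} [MeasurableSpace X] {ι : Type*} [Fintype ι] [DecidableEq ι]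
    (M : POVM X ι) (ρ : Matrix ι ι ℂ) (hρ : ρ.PosSemidef) : Measure X :=
  Measure.ofMeasurable
    (fun B _ => ENNReal.ofReal (Matrix.trace (ρ * M.toVectorMeasure B)).re)
    (by simp)
    (by
      intro f hf hd
      have h1 := M.toVectorMeasure.m_iUnion hf hd
      let φ : Matrix ι ι ℂ →+ ℝ :=
        { toFun := fun A => (Matrix.trace (ρ * A)).re
          map_zero' := by simp
          map_add' := fun A B => by simp [Matrix.mul_add] }
      have hφ : Continuous φ := by
        change Continuous fun A : Matrix ι ι ℂ => (Matrix.trace (ρ * A)).re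
        fun_prop
      have h2 : HasSum (fun i => (Matrix.trace (ρ * M.toVectorMeasure (f i))).re)
          (Matrix.trace (ρ * M.toVectorMeasure (⋃ i, f i))).re := h1.map φ hφ
      rw [← h2.tsum_eq]
      exact ENNReal.ofReal_tsum_of_nonneg
        (fun i => trace_mul_re_nonneg hρ (M.posSemidef _)) h2.summable)

/-- The parameter space `Θ = {θ : |θ| ≤ π}`. The map `θ ↦ [U_θ]` sends it onto `SU(2)/U(1)`. -/
abbrev Param : Type := Metric.closedBall (0 : EuclideanSpace ℝ (Fin 2)) Real.pi

/-- The fidelity `R(θ, θ') = |⟨1/2;1/2| U_θ† U_θ' |1/2;1/2⟩|²`. -/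
def fidelity (θ θ' : EuclideanSpace ℝ (Fin 2)) : ℝ :=
  ‖((rot 1 θ)ᴴ * rot 1 θ') 1 1‖ ^ 2

/-- The worst-case fidelity `R(M) = min_θ ∫ R(θ, θ') Tr ρ_θ M(dθ')` of the estimator `M`. -/
def globalFidelity (n : ℕ) (ρ : Matrix (Fin (n + 1)) (Fin (n + 1)) ℂ) (hρ : ρ.PosSemidef)
    (M : POVM Param (Fin (n + 1))) : ℝ :=
  ⨅ θ : Param, ∫ θ' : Param, fidelity θ θ' ∂(outcomeLaw M (model n ρ θ) (model_posSemidef n hρ θ))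

/-- The global error `η(M) = 4 (1 - R(M))` of the estimator `M`. -/
def globalError (n : ℕ) (ρ : Matrix (Fin (n + 1)) (Fin (n + 1)) ℂ) (hρ : ρ.PosSemidef)
    (M : POVM Param (Fin (n + 1))) : ℝ :=
  4 * (1 - globalFidelity n ρ hρ M)

/-- The optimal global fidelity of the probe `|n/2; a⟩`. -/
def optimalFidelity (n : ℕ) (k : Fin (n + 1)) : ℝ :=
  ⨆ M : POVM Param (Fin (n + 1)), globalFidelity n (dicke n k) (dicke_posSemidef n k) M

/-! ### Local estimation -/

section Local

variable {d : ℕ} {ι : Type*} [Fintype ι] [DecidableEq ι]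

/-- `D` is the partial derivative of the family `ρ` at `θ` in the `i`-th coordinate. -/
def IsPartialDeriv (ρ : EuclideanSpace ℝ (Fin d) → Matrix ι ι ℂ) (θ : EuclideanSpace ℝ (Fin d))
    (i : Fin d) (D : Matrix ι ι ℂ) : Prop :=
  ∀ r s, HasDerivAt (fun t : ℝ => ρ (θ + t • EuclideanSpace.single i (1 : ℝ)) r s) (D r s) 0

/-- `F` is a symmetric logarithmic derivative (SLD) Fisher information matrix of the family `ρ`
at `θ`: there are Hermitian `L_i` with `∂_i ρ = (L_i ρ + ρ L_i)/2` and
`F_{ij} = Tr L_i (L_j ρ + ρ L_j) / 2`. -/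
def IsSLDFisher (ρ : EuclideanSpace ℝ (Fin d) → Matrix ι ι ℂ) (θ : EuclideanSpace ℝ (Fin d))
    (F : Matrix (Fin d) (Fin d) ℝ) : Prop :=
  ∃ L : Fin d → Matrix ι ι ℂ,
    (∀ i, (L i).IsHermitian) ∧
    (∀ i, IsPartialDeriv ρ θ i ((1 / 2 : ℂ) • (L i * ρ θ + ρ θ * L i))) ∧
    ∀ i j, ((F i j : ℝ) : ℂ) = (1 / 2 : ℂ) * Matrix.trace (L i * (L j * ρ θ + ρ θ * L j))

/-- An estimator with finitely many outcomes: a measurement `Π` together with the estimate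
assigned to each outcome. -/
structure LocalEstimator (d : ℕ) (ι : Type*) [Fintype ι] [DecidableEq ι] where
  card : ℕ
  povm : Fin card → Matrix ι ι ℂ
  posSemidef : ∀ x, (povm x).PosSemidef
  total : ∑ x, povm x = 1
  estimate : Fin card → EuclideanSpace ℝ (Fin d)

/-- The expectation of `f(x)` when the state is `σ`. -/
def LocalEstimator.expect (E : LocalEstimator d ι) (σ : Matrix ι ι ℂ) (f : Fin E.card → ℝ) : ℝ :=
  ∑ x, f x * (Matrix.trace (σ * E.povm x)).re

/-- Local unbiasedness at `θ`: the expectation of the estimate of each coordinate is correct at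
`θ`, and correct to first order around `θ`. -/
def LocalEstimator.LocallyUnbiased (E : LocalEstimator d ι)
    (ρ : EuclideanSpace ℝ (Fin d) → Matrix ι ι ℂ) (θ : EuclideanSpace ℝ (Fin d)) : Prop :=
  (∀ i, E.expect (ρ θ) (fun x => E.estimate x i) = θ i) ∧
  ∀ i j, HasDerivAt
    (fun t : ℝ => E.expect (ρ (θ + t • EuclideanSpace.single j (1 : ℝ))) fun x => E.estimate x i)
    (if i = j then 1 else 0) 0

/-- The mean square error matrix `V_θ` of an estimator. -/
def LocalEstimator.mse (E : LocalEstimator d ι) (ρ : EuclideanSpace ℝ (Fin d) → Matrix ι ι ℂ)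
    (θ : EuclideanSpace ℝ (Fin d)) : Matrix (Fin d) (Fin d) ℝ :=
  Matrix.of fun i j =>
    E.expect (ρ θ) fun x => (E.estimate x i - θ i) * (E.estimate x j - θ j)

/-- The tight Cramér-Rao bound `C_θ[G]`: the infimum of `Tr G V_θ` over the estimators that are
locally unbiased at `θ`. It is `∞` if there are none. -/
def tightCR (ρ : EuclideanSpace ℝ (Fin d) → Matrix ι ι ℂ) (θ : EuclideanSpace ℝ (Fin d))
    (G : Matrix (Fin d) (Fin d) ℝ) : ℝ≥0∞ :=
  ⨅ (E : LocalEstimator d ι) (_ : E.LocallyUnbiased ρ θ), ENNReal.ofReal (G * E.mse ρ θ).trace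

end Local

end

end SpinEstimation

namespace SpinEstimation

noncomputable section

/-! ### Real forms of the angular momentum operators -/

/-! Write `j = n/2` and `a = wt n k`.

BFY: on `H_{1/2} ⊗ H_j` the total Casimir is a scalar plus `K = 2 ∑ Jᵢ ⊗ Jᵢ`, and `K² + K = j(j+1)`.
Both spin projections are therefore affine in `K`, whose expectation in the product of the up state
with the Dicke state is `a`; the two sides of the condition differ by `2a/(n(n+2))`
(`BFY_dicke_iff`).

Local part: the tangents `i[Jᵢ, ρ]` of the pure-state model have trace products `2 v δᵢⱼ`, where `v
= (j(j+1) - a²)/2` is the transverse variance. Twice a tangent is an SLD, and every choice of SLDs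
gives `F = 4v` times the identity (`isSLDFisher_dicke_iff`). Measuring one of the two normalized
tangents, chosen at random, is locally unbiased with total error `1/v` (`tightCR_dicke_le`), which
is of order `1/n²` when `|a| ≤ cn` with `c < 1/2`.

Global part: averaging rotated Dicke states over the sphere, weighted by their fidelity to `θ'`,
gives a scalar plus a multiple of the rotated `J₃`, as Schur's lemma and the Wigner–Eckart theorem
predict. Here this is computed from integrals of Wigner functions (`vector_moments`) and realized by
a finite family of parameters (`exists_design`). The family is used twice. As a prior on the true
parameter it bounds the worst case by the average, and the average by the largest eigenvalue of that
operator times the dimension (`globalFidelity_le`). Built from the highest-weight state instead, it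
is a coherent-state measurement whose fidelity is the same for every `θ` and equals the bound
(`exists_globalFidelity_eq`). The optimum is `1/2 + a/(n+2)`, so the global error stays away from
zero unless `a` is close to `n/2`. -/

/-- The coefficient `√((j-m)(j+m+1))` of the raising operator, with `m = s - j`. -/
def ladder (n s : ℕ) : ℝ := Real.sqrt (((n : ℝ) - s) * (s + 1))

theorem ladder_sq {n s : ℕ} (h : s ≤ n) : ladder n s * ladder n s = ((n : ℝ) - s) * (s + 1) := by
  have : (s : ℝ) ≤ n := by exact_mod_cast h
  exact Real.mul_self_sqrt (mul_nonneg (by linarith) (by positivity))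

theorem ladder_pos {n s : ℕ} (h : s < n) : 0 < ladder n s := by
  have : (s : ℝ) < n := by exact_mod_cast h
  exact Real.sqrt_pos.mpr (mul_pos (by linarith) (by positivity))

/-- The raising operator as a real matrix. -/
def raiseR (n : ℕ) : Matrix (Fin (n + 1)) (Fin (n + 1)) ℝ :=
  Matrix.of fun r s => if (r : ℕ) = (s : ℕ) + 1 then ladder n s else 0

/-- The real matrix of `J₁`. -/
def realJ1 (n : ℕ) : Matrix (Fin (n + 1)) (Fin (n + 1)) ℝ :=
  (1 / 2 : ℝ) • (raiseR n + (raiseR n)ᵀ)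

/-- The real matrix of `i J₂`. -/
def realIJ2 (n : ℕ) : Matrix (Fin (n + 1)) (Fin (n + 1)) ℝ :=
  (1 / 2 : ℝ) • (raiseR n - (raiseR n)ᵀ)

/-- The real matrix of `J₃`. -/
def realJ3 (n : ℕ) : Matrix (Fin (n + 1)) (Fin (n + 1)) ℝ := Matrix.diagonal (wt n)

/-- The complexification of real matrices. -/
def complexify (n : ℕ) :
    Matrix (Fin (n + 1)) (Fin (n + 1)) ℝ →+* Matrix (Fin (n + 1)) (Fin (n + 1)) ℂ :=
  Complex.ofRealHom.mapMatrix

theorem complexify_apply (n : ℕ) (A : Matrix (Fin (n + 1)) (Fin (n + 1)) ℝ) (r s : Fin (n + 1)) :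
    complexify n A r s = (A r s : ℂ) := rfl

theorem complexify_smul (n : ℕ) (c : ℝ) (A : Matrix (Fin (n + 1)) (Fin (n + 1)) ℝ) :
    complexify n (c • A) = (c : ℂ) • complexify n A := by
  ext r s; simp [complexify_apply]

theorem complexify_transpose (n : ℕ) (A : Matrix (Fin (n + 1)) (Fin (n + 1)) ℝ) :
    complexify n Aᵀ = (complexify n A)ᴴ := by
  ext r s; simp [complexify_apply]

theorem Jplus_eq (n : ℕ) : Jplus n = complexify n (raiseR n) := by
  ext r s
  simp only [Jplus, raiseR, complexify_apply, Matrix.of_apply]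
  split_ifs with h
  · congr 2
    simp only [wt]; ring
  · simp

theorem Jminus_eq (n : ℕ) : Jminus n = complexify n (raiseR n)ᵀ := by
  rw [Jminus, Jplus_eq, complexify_transpose]

theorem J1_eq (n : ℕ) : J1 n = complexify n (realJ1 n) := by
  rw [J1, Jplus_eq, Jminus_eq, realJ1, complexify_smul, map_add]
  norm_num

theorem J2_eq (n : ℕ) : J2 n = (-Complex.I) • complexify n (realIJ2 n) := by
  rw [J2, Jplus_eq, Jminus_eq, realIJ2, complexify_smul, map_sub, smul_smul]
  congr 1
  push_cast
  field_simp
  simp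

theorem J3_eq (n : ℕ) : J3 n = complexify n (realJ3 n) := by
  ext r s
  simp only [J3, realJ3, complexify_apply, Matrix.diagonal_apply]
  split_ifs <;> simp

theorem raiseR_transpose_mul (n : ℕ) : (raiseR n)ᵀ * raiseR n =
    Matrix.diagonal fun r : Fin (n + 1) => ((n : ℝ) - (r : ℕ)) * ((r : ℕ) + 1) := by
  ext r s
  rw [Matrix.mul_apply]
  simp only [Matrix.transpose_apply, raiseR, Matrix.of_apply, Matrix.diagonal_apply]
  split_ifs with h
  · subst h
    rcases Nat.lt_or_ge (r : ℕ) n with hr | hr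
    · rw [Finset.sum_eq_single ⟨r + 1, by omega⟩]
      · simp only [if_true]
        exact ladder_sq hr.le
      · intro b _ hb
        rw [if_neg, zero_mul]
        intro h; apply hb; ext; simpa using h
      · simp
    -- Top of the ladder: there is no row `n + 1`, and the factor `n - r` vanishes accordingly.
    · have hrn : (r : ℕ) = n := by omega
      rw [Finset.sum_eq_zero]
      · simp [hrn]
      · intro b _
        rw [if_neg (by omega), zero_mul]
  · apply Finset.sum_eq_zero
    intro b _
    by_cases hb : (b : ℕ) = r + 1
    · rw [if_neg (c := (b : ℕ) = s + 1), mul_zero]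
      intro h'; apply h; ext; omega
    · rw [if_neg hb, zero_mul]

theorem raiseR_mul_transpose (n : ℕ) : raiseR n * (raiseR n)ᵀ =
    Matrix.diagonal fun r : Fin (n + 1) => ((n : ℝ) - (r : ℕ) + 1) * (r : ℕ) := by
  ext r s
  rw [Matrix.mul_apply]
  simp only [Matrix.transpose_apply, raiseR, Matrix.of_apply, Matrix.diagonal_apply]
  split_ifs with h
  · subst h
    rcases Nat.eq_zero_or_pos (r : ℕ) with hr | hr
    · rw [Finset.sum_eq_zero]
      · simp [hr]
      · intro b _
        rw [if_neg (by omega), zero_mul]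
    · rw [Finset.sum_eq_single ⟨r - 1, by omega⟩]
      · have h1 : (r : ℕ) = r - 1 + 1 := by omega
        simp only [if_pos h1]
        rw [ladder_sq (by omega), Nat.cast_sub hr]
        push_cast; ring
      · intro b _ hb
        rw [if_neg, zero_mul]
        intro h; apply hb; ext; simp; omega
      · simp
  · apply Finset.sum_eq_zero
    intro b _
    by_cases hb : (r : ℕ) = b + 1
    · rw [if_neg (c := (s : ℕ) = b + 1), mul_zero]
      intro h'; apply h; ext; omega
    · rw [if_neg hb, zero_mul]

theorem raiseR_comm_transpose (n : ℕ) :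
    raiseR n * (raiseR n)ᵀ - (raiseR n)ᵀ * raiseR n = (2 : ℝ) • realJ3 n := by
  rw [raiseR_mul_transpose, raiseR_transpose_mul, Matrix.diagonal_sub, realJ3,
    ← Matrix.diagonal_smul]
  congr 1
  ext r
  simp only [wt, Pi.smul_apply, smul_eq_mul]; ring

theorem realJ3_comm_raiseR (n : ℕ) :
    realJ3 n * raiseR n - raiseR n * realJ3 n = raiseR n := by
  ext r s
  simp only [realJ3, Matrix.sub_apply, Matrix.diagonal_mul, Matrix.mul_diagonal, raiseR,
    Matrix.of_apply]
  split_ifs with h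
  · simp only [wt, h]; push_cast; ring
  · simp

theorem realJ3_transpose (n : ℕ) : (realJ3 n)ᵀ = realJ3 n := Matrix.diagonal_transpose _

theorem realJ3_comm_lower (n : ℕ) :
    realJ3 n * (raiseR n)ᵀ - (raiseR n)ᵀ * realJ3 n = -(raiseR n)ᵀ := by
  have h := congrArg Matrix.transpose (realJ3_comm_raiseR n)
  rw [Matrix.transpose_sub, Matrix.transpose_mul, Matrix.transpose_mul, realJ3_transpose] at h
  rw [← neg_sub, h]

theorem realJ3_comm_realJ1 (n : ℕ) :
    realJ3 n * realJ1 n - realJ1 n * realJ3 n = realIJ2 n := by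
  rw [realJ1, realIJ2, Matrix.mul_smul, Matrix.smul_mul, ← smul_sub, Matrix.mul_add,
    Matrix.add_mul, add_sub_add_comm, realJ3_comm_raiseR, realJ3_comm_lower, sub_eq_add_neg]

theorem realJ3_comm_realIJ2 (n : ℕ) :
    realJ3 n * realIJ2 n - realIJ2 n * realJ3 n = realJ1 n := by
  rw [realJ1, realIJ2, Matrix.mul_smul, Matrix.smul_mul, ← smul_sub, Matrix.mul_sub,
    Matrix.sub_mul, sub_sub_sub_comm, realJ3_comm_raiseR, realJ3_comm_lower, sub_neg_eq_add]

theorem realIJ2_comm_realJ1 (n : ℕ) :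
    realIJ2 n * realJ1 n - realJ1 n * realIJ2 n = realJ3 n := by
  have h := raiseR_comm_transpose n
  have h2 : realJ3 n = (1 / 2 : ℝ) • (raiseR n * (raiseR n)ᵀ - (raiseR n)ᵀ * raiseR n) := by
    rw [h, smul_smul]; norm_num
  rw [h2, realJ1, realIJ2]
  simp only [Matrix.mul_smul, Matrix.smul_mul, Matrix.mul_add, Matrix.add_mul, Matrix.mul_sub,
    Matrix.sub_mul]
  module

/-- The minus sign is there because `realIJ2` represents `i J₂`. The transverse part is `(J₊J₋ +
J₋J₊)/2`, so everything is diagonal and a scalar identity remains. -/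
theorem realCasimir (n : ℕ) :
    realJ1 n * realJ1 n - realIJ2 n * realIJ2 n + realJ3 n * realJ3 n =
      ((n : ℝ) / 2 * (n / 2 + 1)) • (1 : Matrix (Fin (n + 1)) (Fin (n + 1)) ℝ) := by
  have h : realJ1 n * realJ1 n - realIJ2 n * realIJ2 n =
      (1 / 2 : ℝ) • (raiseR n * (raiseR n)ᵀ + (raiseR n)ᵀ * raiseR n) := by
    rw [realJ1, realIJ2]
    simp only [Matrix.mul_smul, Matrix.smul_mul, Matrix.mul_add, Matrix.add_mul, Matrix.mul_sub,
      Matrix.sub_mul]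
    module
  rw [h, raiseR_mul_transpose, raiseR_transpose_mul, realJ3, Matrix.diagonal_mul_diagonal,
    Matrix.diagonal_add, ← Matrix.diagonal_smul, Matrix.diagonal_add, Matrix.smul_one_eq_diagonal]
  congr 1
  ext r
  simp only [wt, Pi.smul_apply, smul_eq_mul]; ring

/-! ### The angular momentum algebra -/

theorem J1_isHermitian (n : ℕ) : (J1 n).IsHermitian := by
  rw [J1_eq, Matrix.IsHermitian, ← complexify_transpose, realJ1, Matrix.transpose_smul,
    Matrix.transpose_add, Matrix.transpose_transpose, add_comm (raiseR n)]

theorem J2_isHermitian (n : ℕ) : (J2 n).IsHermitian := by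
  rw [J2_eq, Matrix.IsHermitian, Matrix.conjTranspose_smul, ← complexify_transpose, realIJ2,
    Matrix.transpose_smul, Matrix.transpose_sub, Matrix.transpose_transpose, ← neg_sub, smul_neg,
    map_neg]
  simp

theorem J3_isHermitian (n : ℕ) : (J3 n).IsHermitian := by
  rw [J3_eq, Matrix.IsHermitian, ← complexify_transpose, realJ3_transpose]

theorem J1_comm_J2 (n : ℕ) : J1 n * J2 n - J2 n * J1 n = Complex.I • J3 n := by
  rw [J1_eq, J2_eq, J3_eq, ← realIJ2_comm_realJ1, map_sub, map_mul, map_mul, Matrix.mul_smul,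
    Matrix.smul_mul]
  module

theorem J2_comm_J3 (n : ℕ) : J2 n * J3 n - J3 n * J2 n = Complex.I • J1 n := by
  rw [J1_eq, J2_eq, J3_eq, ← realJ3_comm_realIJ2, map_sub, map_mul, map_mul, Matrix.mul_smul,
    Matrix.smul_mul]
  module

theorem J3_comm_J1 (n : ℕ) : J3 n * J1 n - J1 n * J3 n = Complex.I • J2 n := by
  rw [J1_eq, J2_eq, J3_eq, smul_smul, ← map_mul, ← map_mul, ← map_sub, realJ3_comm_realJ1]
  simp

theorem casimir (n : ℕ) : J1 n * J1 n + J2 n * J2 n + J3 n * J3 n =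
    (((n : ℝ) / 2 * (n / 2 + 1) : ℝ) : ℂ) • (1 : Matrix (Fin (n + 1)) (Fin (n + 1)) ℂ) := by
  rw [← map_one (complexify n), ← complexify_smul, ← realCasimir, map_add, map_sub, map_mul,
    map_mul, map_mul, J1_eq, J2_eq, J3_eq, Matrix.mul_smul, Matrix.smul_mul, smul_smul]
  simp [sub_eq_add_neg]

/-! ### Addition of a spin `1/2` -/

/-- The operator `2 ∑ᵢ Jᵢ ⊗ Jᵢ` on `H_{1/2} ⊗ H_j`. -/
def spinCoupling (n : ℕ) :
    Matrix (Fin (1 + 1) × Fin (n + 1)) (Fin (1 + 1) × Fin (n + 1)) ℂ :=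
  (2 : ℂ) • (J1 1 ⊗ₖ J1 n + J2 1 ⊗ₖ J2 n + J3 1 ⊗ₖ J3 n)

theorem ladder_one_zero : ladder 1 0 = 1 := by norm_num [ladder]

theorem J1_one : J1 1 = !![0, 1 / 2; 1 / 2, 0] := by
  rw [J1_eq]
  ext r s
  fin_cases r <;> fin_cases s <;> simp [complexify_apply, realJ1, raiseR, ladder_one_zero]

theorem J2_one : J2 1 = !![0, Complex.I / 2; -Complex.I / 2, 0] := by
  rw [J2_eq]
  ext r s
  fin_cases r <;> fin_cases s <;> simp [complexify_apply, realIJ2, raiseR, ladder_one_zero] <;> ring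

theorem J3_one : J3 1 = !![-1 / 2, 0; 0, 1 / 2] := by
  rw [J3_eq]
  ext r s
  fin_cases r <;> fin_cases s <;> simp [complexify_apply, realJ3, wt] <;> norm_num

theorem J1_one_sq : J1 1 * J1 1 = (1 / 4 : ℂ) • 1 := by
  rw [J1_one, Matrix.mul_fin_two, Matrix.one_fin_two]; norm_num

theorem J2_one_sq : J2 1 * J2 1 = (1 / 4 : ℂ) • 1 := by
  rw [J2_one, Matrix.mul_fin_two, Matrix.one_fin_two]
  ext r s
  fin_cases r <;> fin_cases s <;> simp <;> ring_nf <;> simp <;> norm_num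

theorem J3_one_sq : J3 1 * J3 1 = (1 / 4 : ℂ) • 1 := by
  rw [J3_one, Matrix.mul_fin_two, Matrix.one_fin_two]; norm_num

theorem J1_mul_J2_one : J1 1 * J2 1 = (Complex.I / 2) • J3 1 := by
  rw [J1_one, J2_one, J3_one, Matrix.mul_fin_two]
  ext r s
  fin_cases r <;> fin_cases s <;> simp <;> ring_nf

theorem J2_mul_J1_one : J2 1 * J1 1 = (-Complex.I / 2) • J3 1 := by
  rw [J1_one, J2_one, J3_one, Matrix.mul_fin_two]
  ext r s
  fin_cases r <;> fin_cases s <;> simp <;> ring_nf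

theorem J2_mul_J3_one : J2 1 * J3 1 = (Complex.I / 2) • J1 1 := by
  rw [J1_one, J2_one, J3_one, Matrix.mul_fin_two]
  ext r s
  fin_cases r <;> fin_cases s <;> simp <;> ring_nf

theorem J3_mul_J2_one : J3 1 * J2 1 = (-Complex.I / 2) • J1 1 := by
  rw [J1_one, J2_one, J3_one, Matrix.mul_fin_two]
  ext r s
  fin_cases r <;> fin_cases s <;> simp <;> ring_nf

theorem J3_mul_J1_one : J3 1 * J1 1 = (Complex.I / 2) • J2 1 := by
  rw [J1_one, J2_one, J3_one, Matrix.mul_fin_two]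
  ext r s
  fin_cases r <;> fin_cases s <;> simp <;> ring_nf <;> simp
  all_goals ring_nf

theorem J1_mul_J3_one : J1 1 * J3 1 = (-Complex.I / 2) • J2 1 := by
  rw [J1_one, J2_one, J3_one, Matrix.mul_fin_two]
  ext r s
  fin_cases r <;> fin_cases s <;> simp <;> ring_nf <;> simp
  all_goals ring_nf

/-- The spin `1/2` contributes `3 · 1/4`, the spin `j` its own Casimir, and the cross terms form the
coupling. -/
theorem totalCasimir_eq (n : ℕ) : totalCasimir n =
    (((3 / 4 + (n : ℝ) / 2 * (n / 2 + 1) : ℝ)) : ℂ) • 1 + spinCoupling n := by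
  have h := congrArg (fun A => (1 : Matrix (Fin (1 + 1)) (Fin (1 + 1)) ℂ) ⊗ₖ A) (casimir n)
  simp only [Matrix.kronecker_add, Matrix.kronecker_smul, Matrix.one_kronecker_one] at h
  rw [totalCasimir, spinCoupling]
  simp only [pow_two, Matrix.mul_add, Matrix.add_mul, ← Matrix.mul_kronecker_mul, Matrix.one_mul,
    Matrix.mul_one, J1_one_sq, J2_one_sq, J3_one_sq, Matrix.smul_kronecker,
    Matrix.one_kronecker_one]
  rw [Complex.ofReal_add, add_smul, ← h]
  push_cast
  module

/-- By the Pauli relations the diagonal products sum to the Casimir of spin `j`, while the mixed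
ones pair into commutators `[Jᵢ, Jₖ]` and give back minus the coupling. The possible eigenvalues are
thus `j` and `-(j+1)`. -/
theorem spinCoupling_mul_self (n : ℕ) : spinCoupling n * spinCoupling n =
    (((n : ℝ) / 2 * (n / 2 + 1) : ℝ) : ℂ) • 1 - spinCoupling n := by
  have h := congrArg (fun A => (1 : Matrix (Fin (1 + 1)) (Fin (1 + 1)) ℂ) ⊗ₖ A) (casimir n)
  simp only [Matrix.kronecker_add, Matrix.kronecker_smul, Matrix.one_kronecker_one] at h
  have e1 : J1 n * J2 n = J2 n * J1 n + Complex.I • J3 n := sub_eq_iff_eq_add'.mp (J1_comm_J2 n)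
  have e2 : J2 n * J3 n = J3 n * J2 n + Complex.I • J1 n := sub_eq_iff_eq_add'.mp (J2_comm_J3 n)
  have e3 : J3 n * J1 n = J1 n * J3 n + Complex.I • J2 n := sub_eq_iff_eq_add'.mp (J3_comm_J1 n)
  rw [← h, spinCoupling]
  simp only [Matrix.smul_mul, Matrix.mul_smul, Matrix.mul_add, Matrix.add_mul,
    ← Matrix.mul_kronecker_mul, J1_one_sq, J2_one_sq, J3_one_sq, J1_mul_J2_one, J2_mul_J1_one,
    J2_mul_J3_one, J3_mul_J2_one, J3_mul_J1_one, J1_mul_J3_one, Matrix.smul_kronecker]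
  rw [e1, e2, e3]
  simp only [Matrix.kronecker_add, Matrix.kronecker_smul, smul_add, smul_smul]
  have hI : Complex.I / 2 * Complex.I = -(1 / 2) := by
    rw [div_mul_eq_mul_div, Complex.I_mul_I]; norm_num
  rw [hI]
  module

theorem spinCoupling_isHermitian (n : ℕ) : (spinCoupling n).IsHermitian := by
  rw [spinCoupling, Matrix.IsHermitian, Matrix.conjTranspose_smul, Matrix.conjTranspose_add,
    Matrix.conjTranspose_add, Matrix.conjTranspose_kronecker, Matrix.conjTranspose_kronecker,
    Matrix.conjTranspose_kronecker, (J1_isHermitian 1).eq, (J1_isHermitian n).eq,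
    (J2_isHermitian 1).eq, (J2_isHermitian n).eq, (J3_isHermitian 1).eq, (J3_isHermitian n).eq]
  simp

/-- If `A` is Hermitian with `(A - x)(A - y) = 0`, `x ≠ y`, then the orthogonal projection onto the
eigenspace of `A` for `x` is `(A - y)/(x - y)`. -/
theorem toEuclideanLin_symm_starProjection_eigenspace {ι : Type*} [Fintype ι] [DecidableEq ι]
    {A : Matrix ι ι ℂ} (hA : A.IsHermitian) {x y : ℝ} (hxy : x ≠ y)
    (h : (A - (x : ℂ) • 1) * (A - (y : ℂ) • 1) = 0) :
    Matrix.toEuclideanLin.symm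
      (Module.End.eigenspace (Matrix.toEuclideanLin A) (x : ℂ)).starProjection.toLinearMap =
      ((x - y : ℝ) : ℂ)⁻¹ • (A - (y : ℂ) • 1) := by
  have hne : ((x - y : ℝ) : ℂ) ≠ 0 := by
    rw [Complex.ofReal_ne_zero]; exact sub_ne_zero.mpr hxy
  rw [LinearEquiv.symm_apply_eq]
  set T := Matrix.toEuclideanLin A with hT
  have hP : ∀ v, Matrix.toEuclideanLin (((x - y : ℝ) : ℂ)⁻¹ • (A - (y : ℂ) • 1)) v =
      ((x - y : ℝ) : ℂ)⁻¹ • (T v - (y : ℂ) • v) := by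
    intro v
    rw [map_smul, map_sub, map_smul]
    simp [hT, Matrix.toLpLin_one]
  have hTT : ∀ v, T (T v) - (y : ℂ) • T v = (x : ℂ) • (T v - (y : ℂ) • v) := by
    intro v
    have h' := congrArg (fun B => Matrix.toEuclideanLin B v) h
    simp only [Matrix.mul_sub, Matrix.sub_mul, Matrix.mul_smul, Matrix.smul_mul, Matrix.mul_one,
      Matrix.one_mul, map_sub, map_smul, map_zero, Matrix.toLpLin_mul_same] at h'
    simp [Matrix.toLpLin_one, ← hT] at h'
    rw [← sub_eq_zero, ← h']
    module
  have hsymm : T.IsSymmetric := Matrix.isSymmetric_toEuclideanLin_iff.mpr hA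
  ext1 v
  rw [ContinuousLinearMap.coe_coe, hP]
  -- The candidate lies in the eigenspace by the quadratic relation. The remainder `(x - T)v/(x -
  -- y)` is orthogonal to it because `T` is symmetric and `x` is real.
  apply Submodule.eq_starProjection_of_mem_of_inner_eq_zero
  · rw [Module.End.mem_eigenspace_iff, map_smul, map_sub, map_smul, hTT, smul_comm]
  · intro w hw
    rw [Module.End.mem_eigenspace_iff] at hw
    have e : v - ((x - y : ℝ) : ℂ)⁻¹ • (T v - (y : ℂ) • v) =
        ((x - y : ℝ) : ℂ)⁻¹ • ((x : ℂ) • v - T v) := by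
      have : v = ((x - y : ℝ) : ℂ)⁻¹ • (((x - y : ℝ) : ℂ) • v) := by
        rw [smul_smul, inv_mul_cancel₀ hne, one_smul]
      nth_rw 1 [this]
      rw [← smul_sub]
      congr 1
      push_cast
      module
    rw [e, inner_smul_left, inner_sub_left, hsymm v w, hw, inner_smul_left, inner_smul_right]
    simp

theorem totalCasimir_isHermitian (n : ℕ) : (totalCasimir n).IsHermitian := by
  rw [totalCasimir_eq, Matrix.IsHermitian, Matrix.conjTranspose_add,
    (spinCoupling_isHermitian n).eq, Matrix.conjTranspose_smul, Matrix.conjTranspose_one]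
  simp

/-- Vieta: with `q = j(j+1)`, the shifts `3/4 + q - x` and `3/4 + q - y` have sum `1` and product
`-q`, which matches `K² + K - q = 0` for the coupling `K`. -/
theorem totalCasimir_roots (n : ℕ) {x y : ℝ}
    (hs : x + y = 1 / 2 + 2 * ((n : ℝ) / 2 * (n / 2 + 1)))
    (hp : (3 / 4 + (n : ℝ) / 2 * (n / 2 + 1) - x) * (3 / 4 + (n : ℝ) / 2 * (n / 2 + 1) - y) =
      -((n : ℝ) / 2 * (n / 2 + 1))) :
    (totalCasimir n - (x : ℂ) • 1) * (totalCasimir n - (y : ℂ) • 1) = 0 := by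
  have hy : y = 1 / 2 + 2 * ((n : ℝ) / 2 * (n / 2 + 1)) - x := by linarith
  subst hy
  have hK := spinCoupling_mul_self n
  rw [totalCasimir_eq]
  generalize (n : ℝ) / 2 * (n / 2 + 1) = q at *
  have e : ∀ z : ℝ, ((3 / 4 + q : ℝ) : ℂ) • 1 + spinCoupling n - (z : ℂ) • 1 =
      spinCoupling n + ((3 / 4 + q - z : ℝ) : ℂ) • 1 := by
    intro z; push_cast; module
  rw [e, e, Matrix.add_mul, Matrix.mul_add, hK, Matrix.smul_mul, Matrix.mul_smul, Matrix.mul_one,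
    Matrix.one_mul, smul_add, smul_smul, ← Complex.ofReal_mul, hp]
  push_cast
  module

/-- The trace reads off one diagonal entry of a polynomial of degree one in the Casimir. In the
coupling only `2 J₃ ⊗ J₃` contributes, with value `2 · (1/2) · a`. -/
theorem spinWeight_dicke (n : ℕ) (k : Fin (n + 1)) {s t : ℝ} (hst : s * (s + 1) ≠ t * (t + 1))
    (hs : s * (s + 1) + t * (t + 1) = 1 / 2 + 2 * ((n : ℝ) / 2 * (n / 2 + 1)))
    (hp : (3 / 4 + (n : ℝ) / 2 * (n / 2 + 1) - s * (s + 1)) *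
      (3 / 4 + (n : ℝ) / 2 * (n / 2 + 1) - t * (t + 1)) = -((n : ℝ) / 2 * (n / 2 + 1))) :
    spinWeight n (dicke n k) s = (s * (s + 1) - t * (t + 1))⁻¹ *
      (3 / 4 + (n : ℝ) / 2 * (n / 2 + 1) + wt n k - t * (t + 1)) := by
  have hproj : totalSpinProj n s = _ := toEuclideanLin_symm_starProjection_eigenspace (totalCasimir_isHermitian n) hst
    (totalCasimir_roots n hs hp)
  have h0 : (J1 1) 1 1 = 0 := by rw [J1_one]; simp
  have h1 : (J2 1) 1 1 = 0 := by rw [J2_one]; simp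
  have h2 : (J3 1) 1 1 = 1 / 2 := by rw [J3_one]; simp
  have h3 : (J3 n) k k = (wt n k : ℂ) := by simp [J3]
  rw [spinWeight, hproj, dicke, dicke,
    Matrix.single_kronecker_single, one_mul, Matrix.trace_mul_single]
  simp only [Matrix.smul_apply, Matrix.sub_apply, totalCasimir_eq, spinCoupling, Matrix.add_apply,
    Matrix.kroneckerMap_apply, h0, h1, h2, h3, Matrix.one_apply_eq, smul_eq_mul]
  rw [MulOpposite.op_one, one_smul]
  refine Eq.trans (congrArg Complex.re ?_) (Complex.ofReal_re _)
  push_cast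
  ring

theorem BFY_dicke_iff (n : ℕ) (k : Fin (n + 1)) (hn : 1 ≤ n) :
    BFY n (dicke n k) ↔ 0 ≤ wt n k := by
  have hn' : (1 : ℝ) ≤ n := by exact_mod_cast hn
  have hne : ((n : ℝ) / 2 + 1 / 2) * (n / 2 + 1 / 2 + 1) ≠ (n / 2 - 1 / 2) * (n / 2 - 1 / 2 + 1) := by
    intro h; nlinarith
  have e1 := spinWeight_dicke n k hne (by ring) (by ring)
  have e2 := spinWeight_dicke n k hne.symm (by ring) (by ring)
  have e3 : ((n : ℝ) / 2 + 1 / 2) * (n / 2 + 1 / 2 + 1) - (n / 2 - 1 / 2) * (n / 2 - 1 / 2 + 1) =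
    n + 1 := by ring
  have e4 : ((n : ℝ) / 2 - 1 / 2) * (n / 2 - 1 / 2 + 1) - (n / 2 + 1 / 2) * (n / 2 + 1 / 2 + 1) =
    -(n + 1) := by ring
  rw [e3] at e1
  rw [e4] at e2
  rw [BFY, e1, e2, ge_iff_le, ← sub_nonneg]
  -- Both weights are affine in `a`, and in the difference of the two sides the constant terms
  -- cancel.
  have e5 : 1 / ((n : ℝ) + 2) * (((n : ℝ) + 1)⁻¹ * (3 / 4 + (n : ℝ) / 2 * (n / 2 + 1) + wt n k -
      (n / 2 - 1 / 2) * (n / 2 - 1 / 2 + 1))) -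
      1 / (n : ℝ) * ((-((n : ℝ) + 1))⁻¹ * (3 / 4 + (n : ℝ) / 2 * (n / 2 + 1) + wt n k -
        (n / 2 + 1 / 2) * (n / 2 + 1 / 2 + 1))) = 2 / (n * (n + 2)) * wt n k := by
    rw [inv_neg]
    field_simp
    ring
  rw [e5]
  exact mul_nonneg_iff_of_pos_left (by positivity)

/-! ### Expectations in Dicke states -/

theorem dicke_mul_mul_dicke (n : ℕ) (k : Fin (n + 1)) (A : Matrix (Fin (n + 1)) (Fin (n + 1)) ℂ) :
    dicke n k * A * dicke n k = A k k • dicke n k := by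
  rw [dicke, Matrix.single_mul_mul_single, Matrix.smul_single]
  simp

theorem trace_mul_dicke (n : ℕ) (k : Fin (n + 1)) (A : Matrix (Fin (n + 1)) (Fin (n + 1)) ℂ) :
    (A * dicke n k).trace = A k k := by
  rw [dicke, Matrix.trace_mul_single]; simp

theorem trace_dicke (n : ℕ) (k : Fin (n + 1)) : (dicke n k).trace = 1 := by
  simp [dicke]

theorem dicke_isHermitian (n : ℕ) (k : Fin (n + 1)) : (dicke n k)ᴴ = dicke n k :=
  (dicke_posSemidef n k).1

theorem dicke_mul_self (n : ℕ) (k : Fin (n + 1)) : dicke n k * dicke n k = dicke n k := by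
  simp [dicke]

/-- Dicke states are eigenvectors of `J₃`. Applied to `J₁²` and to `J₁J₂`, this gives the second
moments of the transverse components. -/
theorem J3_comm_apply_self (n : ℕ) (k : Fin (n + 1)) (A : Matrix (Fin (n + 1)) (Fin (n + 1)) ℂ) :
    (J3 n * A - A * J3 n) k k = 0 := by
  rw [J3, Matrix.sub_apply, Matrix.diagonal_mul, Matrix.mul_diagonal]; ring

theorem J1_apply_self (n : ℕ) (k : Fin (n + 1)) : J1 n k k = 0 := by
  simp [J1_eq, complexify_apply, realJ1, raiseR]

theorem J2_apply_self (n : ℕ) (k : Fin (n + 1)) : J2 n k k = 0 := by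
  simp [J2_eq, complexify_apply, realIJ2, raiseR]

/-- The variance of `J₁` and of `J₂` in the state `|j;m⟩`. -/
def transverseVar (n : ℕ) (k : Fin (n + 1)) : ℝ :=
  ((n : ℝ) / 2 * (n / 2 + 1) - wt n k ^ 2) / 2

theorem J1_J2_anticomm_apply_self (n : ℕ) (k : Fin (n + 1)) :
    (J1 n * J2 n) k k + (J2 n * J1 n) k k = 0 := by
  have h := J3_comm_apply_self n k (J1 n * J1 n)
  have e3 : J3 n * J1 n = J1 n * J3 n + Complex.I • J2 n := sub_eq_iff_eq_add'.mp (J3_comm_J1 n)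
  have e : J3 n * (J1 n * J1 n) - J1 n * J1 n * J3 n =
      Complex.I • (J1 n * J2 n + J2 n * J1 n) := by
    rw [← Matrix.mul_assoc, e3, Matrix.add_mul, Matrix.mul_assoc, e3, Matrix.mul_add,
      ← Matrix.mul_assoc, Matrix.mul_smul, Matrix.smul_mul]
    module
  rw [e, Matrix.smul_apply, smul_eq_mul] at h
  exact (mul_eq_zero.mp h).resolve_left Complex.I_ne_zero

/-- From `[J₃, J₁J₂] = i(J₂² - J₁²)` the two expectations agree; the Casimir fixes their sum. -/
theorem J1_sq_J2_sq_apply_self (n : ℕ) (k : Fin (n + 1)) :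
    (J1 n * J1 n) k k = (transverseVar n k : ℂ) ∧ (J2 n * J2 n) k k = (transverseVar n k : ℂ) := by
  have h := J3_comm_apply_self n k (J1 n * J2 n)
  have e3 : J3 n * J1 n = J1 n * J3 n + Complex.I • J2 n := sub_eq_iff_eq_add'.mp (J3_comm_J1 n)
  have e2 : J2 n * J3 n = J3 n * J2 n + Complex.I • J1 n := sub_eq_iff_eq_add'.mp (J2_comm_J3 n)
  have e : J3 n * (J1 n * J2 n) - J1 n * J2 n * J3 n =
      Complex.I • (J2 n * J2 n - J1 n * J1 n) := by
    rw [← Matrix.mul_assoc, e3, Matrix.add_mul, Matrix.mul_assoc (J1 n) (J2 n), e2, Matrix.mul_add,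
      ← Matrix.mul_assoc, Matrix.mul_smul, Matrix.smul_mul]
    module
  rw [e, Matrix.smul_apply, smul_eq_mul] at h
  have h1 := (mul_eq_zero.mp h).resolve_left Complex.I_ne_zero
  rw [Matrix.sub_apply, sub_eq_zero] at h1
  have h2 := congrFun (congrFun (casimir n) k) k
  have h3 : (J3 n * J3 n) k k = (wt n k : ℂ) ^ 2 := by
    rw [J3, Matrix.diagonal_mul_diagonal, Matrix.diagonal_apply_eq, pow_two]
  rw [Matrix.add_apply, Matrix.add_apply, h3, h1, Matrix.smul_apply, Matrix.one_apply_eq] at h2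
  have h4 : (J1 n * J1 n) k k = (transverseVar n k : ℂ) := by
    simp only [smul_eq_mul, mul_one] at h2
    rw [transverseVar]
    push_cast at h2 ⊢
    linear_combination h2 / 2
  exact ⟨h4, h1.trans h4⟩

theorem abs_wt_le (n : ℕ) (k : Fin (n + 1)) : |wt n k| ≤ (n : ℝ) / 2 := by
  have : ((k : ℕ) : ℝ) ≤ n := by exact_mod_cast (by omega : (k : ℕ) ≤ n)
  have h0 : (0 : ℝ) ≤ ((k : ℕ) : ℝ) := by positivity
  rw [wt, abs_le]; constructor <;> linarith

theorem transverseVar_pos (n : ℕ) (k : Fin (n + 1)) (hn : 1 ≤ n) : 0 < transverseVar n k := by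
  have h := abs_le.mp (abs_wt_le n k)
  have hn' : (1 : ℝ) ≤ n := by exact_mod_cast hn
  rw [transverseVar]; nlinarith

/-! ### The tangent space of the model -/

/-- The generators `J₁, J₂` of the model. -/
def generator (n : ℕ) : Fin 2 → Matrix (Fin (n + 1)) (Fin (n + 1)) ℂ := ![J1 n, J2 n]

theorem generator_isHermitian (n : ℕ) (i : Fin 2) : (generator n i)ᴴ = generator n i := by
  fin_cases i
  · exact (J1_isHermitian n)
  · exact (J2_isHermitian n)

theorem generator_apply_self (n : ℕ) (i : Fin 2) (k : Fin (n + 1)) : generator n i k k = 0 := by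
  fin_cases i
  · exact (J1_apply_self n k)
  · exact (J2_apply_self n k)

theorem generator_anticomm_apply_self (n : ℕ) (i j : Fin 2) (k : Fin (n + 1)) :
    (generator n i * generator n j) k k + (generator n j * generator n i) k k =
      if i = j then 2 * (transverseVar n k : ℂ) else 0 := by
  have h1 := J1_sq_J2_sq_apply_self n k
  have h2 := J1_J2_anticomm_apply_self n k
  fin_cases i <;> fin_cases j
  · simp [generator, h1.1, two_mul]
  · simpa [generator] using h2
  · simpa [generator, add_comm] using h2
  · simp [generator, h1.2, two_mul]

/-- The derivative `i[J_i, ρ]` of the model at the Dicke state `ρ`. -/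
def tangent (n : ℕ) (k : Fin (n + 1)) (i : Fin 2) : Matrix (Fin (n + 1)) (Fin (n + 1)) ℂ :=
  Complex.I • (generator n i * dicke n k - dicke n k * generator n i)

theorem tangent_isHermitian (n : ℕ) (k : Fin (n + 1)) (i : Fin 2) :
    (tangent n k i)ᴴ = tangent n k i := by
  rw [tangent, Matrix.conjTranspose_smul, Matrix.conjTranspose_sub, Matrix.conjTranspose_mul,
    Matrix.conjTranspose_mul, dicke_isHermitian, generator_isHermitian, ← neg_sub, smul_neg,
    ← neg_smul]
  simp

theorem dicke_mul_generator_mul_dicke (n : ℕ) (k : Fin (n + 1)) (i : Fin 2) :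
    dicke n k * (generator n i * dicke n k) = 0 := by
  rw [← Matrix.mul_assoc, dicke_mul_mul_dicke, generator_apply_self, zero_smul]

theorem dicke_mul_generator_mul_dicke_mul (n : ℕ) (k : Fin (n + 1)) (i : Fin 2)
    (A : Matrix (Fin (n + 1)) (Fin (n + 1)) ℂ) :
    dicke n k * (generator n i * (dicke n k * A)) = 0 := by
  rw [← Matrix.mul_assoc, ← Matrix.mul_assoc, Matrix.mul_assoc (dicke n k),
    dicke_mul_generator_mul_dicke, Matrix.zero_mul]

/-- This is the derivative of `ρ² = ρ`, and it makes twice the tangent an SLD. -/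
theorem tangent_eq (n : ℕ) (k : Fin (n + 1)) (i : Fin 2) :
    tangent n k i * dicke n k + dicke n k * tangent n k i = tangent n k i := by
  simp only [tangent, Matrix.smul_mul, Matrix.mul_smul, Matrix.sub_mul, Matrix.mul_sub,
    Matrix.mul_assoc, dicke_mul_self, dicke_mul_generator_mul_dicke]
  rw [← Matrix.mul_assoc, dicke_mul_self]
  module

theorem tangent_mul_tangent (n : ℕ) (k : Fin (n + 1)) (i j : Fin 2) :
    tangent n k i * tangent n k j = generator n i * dicke n k * generator n j +
      (generator n i * generator n j) k k • dicke n k := by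
  rw [← dicke_mul_mul_dicke]
  simp only [tangent, Matrix.smul_mul, Matrix.mul_smul, Matrix.sub_mul, Matrix.mul_sub,
    Matrix.mul_assoc, dicke_mul_generator_mul_dicke, Matrix.mul_zero]
  have h1 : dicke n k * (dicke n k * generator n j) = dicke n k * generator n j := by
    rw [← Matrix.mul_assoc, dicke_mul_self]
  rw [h1, dicke_mul_generator_mul_dicke_mul]
  simp only [smul_sub, smul_smul, Complex.I_mul_I]
  module

theorem trace_tangent_mul_tangent (n : ℕ) (k : Fin (n + 1)) (i j : Fin 2) :
    (tangent n k i * tangent n k j).trace = if i = j then 2 * (transverseVar n k : ℂ) else 0 := by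
  rw [tangent_mul_tangent, Matrix.trace_add, Matrix.trace_mul_comm, ← Matrix.mul_assoc,
    trace_mul_dicke, Matrix.trace_smul, trace_dicke, smul_eq_mul, mul_one, add_comm,
    generator_anticomm_apply_self]

/-- Up to phases the tangent exchanges the Dicke vector with `Jᵢ` applied to it. These two are
orthogonal and the second has squared length `v`, so the eigenvalues are among `0, ±√v`. -/
theorem tangent_pow_three (n : ℕ) (k : Fin (n + 1)) (i : Fin 2) :
    tangent n k i * tangent n k i * tangent n k i =
      (transverseVar n k : ℂ) • tangent n k i := by
  have h := generator_anticomm_apply_self n i i k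
  rw [if_pos rfl, ← two_mul] at h
  have h' := mul_left_cancel₀ two_ne_zero h
  have h4 : generator n i * (dicke n k * (generator n i * (generator n i * dicke n k))) =
      (transverseVar n k : ℂ) • (generator n i * dicke n k) := by
    rw [← h', ← Matrix.mul_smul, ← dicke_mul_mul_dicke]
    simp only [Matrix.mul_assoc]
  have h5 : dicke n k * (dicke n k * generator n i) = dicke n k * generator n i := by
    rw [← Matrix.mul_assoc, dicke_mul_self]
  rw [tangent_mul_tangent, h']
  simp only [tangent, Matrix.smul_mul, Matrix.mul_smul, Matrix.mul_sub, Matrix.add_mul,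
    Matrix.mul_assoc, dicke_mul_generator_mul_dicke, dicke_mul_generator_mul_dicke_mul, h4, h5,
    Matrix.mul_zero]
  module

-- Composition with a linear `φ` keeps the statement free of any choice of matrix norm and covers
-- matrix entries and expectation values alike.
open scoped Matrix.Norms.Operator in
theorem hasDerivAt_linearMap_exp_conj {ι E : Type*} [Fintype ι] [DecidableEq ι]
    [NormedAddCommGroup E] [NormedSpace ℝ E] (φ : Matrix ι ι ℂ →ₗ[ℝ] E) (B ρ : Matrix ι ι ℂ) :
    HasDerivAt (fun t : ℝ => φ (NormedSpace.exp (t • B) * ρ * (NormedSpace.exp (t • B))ᴴ))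
      (φ (B * ρ + ρ * Bᴴ)) 0 := by
  have h1 := hasDerivAt_exp_smul_const B (0 : ℝ)
  have h2 := hasDerivAt_exp_smul_const Bᴴ (0 : ℝ)
  have h3 := (h1.mul_const ρ).mul h2
  have h4 := (LinearMap.toContinuousLinearMap φ).hasFDerivAt.comp_hasDerivAt (0 : ℝ) h3
  convert h4 using 1
  · ext t
    simp [← Matrix.exp_conjTranspose]
    rfl
  · simp [-map_add]
    rfl

theorem rot_smul_single (n : ℕ) (i : Fin 2) (t : ℝ) :
    rot n (0 + t • EuclideanSpace.single i (1 : ℝ)) =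
      NormedSpace.exp (t • (Complex.I • generator n i)) := by
  rw [rot]
  congr 1
  fin_cases i <;> simp [generator] <;> exact smul_comm _ _ _

theorem rot_zero (n : ℕ) : rot n 0 = 1 := by simp [rot]

theorem model_zero (n : ℕ) (ρ : Matrix (Fin (n + 1)) (Fin (n + 1)) ℂ) : model n ρ 0 = ρ := by
  simp [model, rot_zero]

theorem hasDerivAt_linearMap_model {E : Type*} [NormedAddCommGroup E] [NormedSpace ℝ E] (n : ℕ)
    (k : Fin (n + 1)) (φ : Matrix (Fin (n + 1)) (Fin (n + 1)) ℂ →ₗ[ℝ] E) (i : Fin 2) :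
    HasDerivAt (fun t : ℝ => φ (model n (dicke n k) (0 + t • EuclideanSpace.single i (1 : ℝ))))
      (φ (tangent n k i)) 0 := by
  have h := hasDerivAt_linearMap_exp_conj φ (Complex.I • generator n i) (dicke n k)
  have e : Complex.I • generator n i * dicke n k + dicke n k * (Complex.I • generator n i)ᴴ =
      tangent n k i := by
    rw [Matrix.conjTranspose_smul, generator_isHermitian, tangent, Matrix.smul_mul,
      Matrix.mul_smul]
    simp
    module
  rw [e] at h
  simp only [model, rot_smul_single]
  exact h

theorem isPartialDeriv_model_iff (n : ℕ) (k : Fin (n + 1)) (i : Fin 2)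
    (D : Matrix (Fin (n + 1)) (Fin (n + 1)) ℂ) :
    IsPartialDeriv (model n (dicke n k)) 0 i D ↔ D = tangent n k i := by
  have h : ∀ r s, HasDerivAt
      (fun t : ℝ => model n (dicke n k) (0 + t • EuclideanSpace.single i (1 : ℝ)) r s)
      (tangent n k i r s) 0 := fun r s =>
    hasDerivAt_linearMap_model n k (Matrix.entryLinearMap ℝ ℂ r s) i
  constructor
  · intro hD
    ext r s
    exact (hD r s).unique (h r s)
  · rintro rfl
    exact h

/-! ### The SLD Fisher information -/

/-- SLDs of a pure state are not unique, but `F` is. Writing a tangent as its anticommutator with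
`ρ` and moving that anticommutator across the trace onto `Lᵢ` leaves `2 Tr TᵢTⱼ`, which involves
only the tangents `Tᵢ`. -/
theorem isSLDFisher_dicke_iff (n : ℕ) (k : Fin (n + 1)) (F : Matrix (Fin 2) (Fin 2) ℝ) :
    IsSLDFisher (model n (dicke n k)) 0 F ↔
      F = Matrix.diagonal fun _ => 4 * transverseVar n k := by
  simp only [IsSLDFisher, isPartialDeriv_model_iff, model_zero]
  constructor
  · rintro ⟨L, -, hD, hF⟩
    ext i j
    have h1 : (1 / 2 : ℂ) * Matrix.trace (L i * (L j * dicke n k + dicke n k * L j)) =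
        Matrix.trace (L i * tangent n k j) := by
      rw [← hD j, Matrix.mul_smul, Matrix.trace_smul, smul_eq_mul]
    have h2 : Matrix.trace (L i * tangent n k j) =
        2 * Matrix.trace (tangent n k i * tangent n k j) := by
      rw [← hD i, ← tangent_eq n k j, Matrix.smul_mul, Matrix.trace_smul, smul_eq_mul,
        Matrix.mul_add, Matrix.trace_add, ← Matrix.mul_assoc, Matrix.trace_mul_comm,
        ← Matrix.mul_assoc, ← Matrix.mul_assoc, ← Matrix.trace_add, ← Matrix.add_mul, tangent_eq,
        add_comm (dicke n k * L i)]
      ring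
    have h3 := hF i j
    rw [h1, h2, trace_tangent_mul_tangent] at h3
    rw [Matrix.diagonal_apply]
    split_ifs at h3 ⊢ with hij
    · have : ((F i j : ℝ) : ℂ) = ((4 * transverseVar n k : ℝ) : ℂ) := by
        rw [h3]; push_cast; ring
      exact_mod_cast this
    · simpa using h3
  · rintro rfl
    refine ⟨fun i => (2 : ℂ) • tangent n k i, fun i => ?_, fun i => ?_, fun i j => ?_⟩
    · rw [Matrix.IsHermitian, Matrix.conjTranspose_smul, tangent_isHermitian]; simp
    · rw [Matrix.smul_mul, Matrix.mul_smul, ← smul_add, tangent_eq, smul_smul]; norm_num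
    · rw [Matrix.smul_mul, Matrix.mul_smul, Matrix.smul_mul, ← smul_add, tangent_eq,
        Matrix.mul_smul, Matrix.trace_smul, Matrix.trace_smul, trace_tangent_mul_tangent,
        Matrix.diagonal_apply]
      split_ifs
      · push_cast; simp only [smul_eq_mul]; ring
      · simp

/-! ### A locally unbiased estimator with Heisenberg scaling -/

/-- If `Q` is Hermitian with `Q³ = Q`, then `1 + Q` is positive. -/
theorem posSemidef_one_add {ι : Type*} [Fintype ι] [DecidableEq ι] {Q : Matrix ι ι ℂ}
    (hQ : Qᴴ = Q) (h3 : Q * Q * Q = Q) : (1 + Q).PosSemidef := by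
  -- The certificate is `1 + Q = (1 - Q²)² + (Q + Q²)²/2`, valid when `Q³ = Q`.
  have h1 := Matrix.posSemidef_conjTranspose_mul_self (1 - Q * Q)
  have h2 := (Matrix.posSemidef_conjTranspose_mul_self (Q + Q * Q)).smul
    (show (0 : ℝ) ≤ 1 / 2 by norm_num)
  have h4 : Q * Q * (Q * Q) = Q * Q := by rw [← Matrix.mul_assoc, h3]
  have h5 : Q * (Q * Q) = Q := by rw [← Matrix.mul_assoc, h3]
  convert h1.add h2 using 1
  simp only [Matrix.conjTranspose_sub, Matrix.conjTranspose_add, Matrix.conjTranspose_one,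
    Matrix.conjTranspose_mul, hQ, Matrix.sub_mul, Matrix.mul_sub, Matrix.add_mul, Matrix.mul_add,
    Matrix.one_mul, Matrix.mul_one, h4, h5, h3]
  module

/-- The normalized tangent operator. -/
def unitTangent (n : ℕ) (k : Fin (n + 1)) (i : Fin 2) : Matrix (Fin (n + 1)) (Fin (n + 1)) ℂ :=
  ((Real.sqrt (transverseVar n k))⁻¹ : ℝ) • tangent n k i

theorem unitTangent_isHermitian (n : ℕ) (k : Fin (n + 1)) (i : Fin 2) :
    (unitTangent n k i)ᴴ = unitTangent n k i := by
  rw [unitTangent, Matrix.conjTranspose_smul, tangent_isHermitian]; simp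

theorem unitTangent_pow_three (n : ℕ) (k : Fin (n + 1)) (hn : 1 ≤ n) (i : Fin 2) :
    unitTangent n k i * unitTangent n k i * unitTangent n k i = unitTangent n k i := by
  have hv := transverseVar_pos n k hn
  have h0 : Real.sqrt (transverseVar n k) ≠ 0 := (Real.sqrt_pos.mpr hv).ne'
  have h1 : Real.sqrt (transverseVar n k) * Real.sqrt (transverseVar n k) = transverseVar n k :=
    Real.mul_self_sqrt hv.le
  simp only [unitTangent, Matrix.smul_mul, Matrix.mul_smul, tangent_pow_three, smul_smul]
  rw [Complex.coe_smul, smul_smul]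
  congr 1
  nth_rw 4 [← h1]
  field_simp

/-- The estimator that measures one of the two unit tangent operators, chosen at random. -/
def tangentEstimator (n : ℕ) (k : Fin (n + 1)) (hn : 1 ≤ n) : LocalEstimator 2 (Fin (n + 1)) where
  card := 4
  povm := ![(1 / 4 : ℝ) • (1 + unitTangent n k 0), (1 / 4 : ℝ) • (1 + -unitTangent n k 0),
    (1 / 4 : ℝ) • (1 + unitTangent n k 1), (1 / 4 : ℝ) • (1 + -unitTangent n k 1)]
  posSemidef := by
    have h4 : (0 : ℝ) ≤ 1 / 4 := by norm_num
    have hp : ∀ i, ((1 / 4 : ℝ) • (1 + unitTangent n k i)).PosSemidef := fun i =>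
      (posSemidef_one_add (unitTangent_isHermitian n k i) (unitTangent_pow_three n k hn i)).smul h4
    have hm : ∀ i, ((1 / 4 : ℝ) • (1 + -unitTangent n k i)).PosSemidef := fun i =>
      (posSemidef_one_add (by rw [Matrix.conjTranspose_neg, unitTangent_isHermitian])
        (by simp [unitTangent_pow_three n k hn i])).smul h4
    intro x
    fin_cases x
    exacts [hp 0, hm 0, hp 1, hm 1]
  total := by
    simp only [Fin.sum_univ_four]
    simp
    module
  -- The size `v^(-1/2)` makes the mean estimate `Tr(σTᵢ)/(2v)`, which has unit slope since `Tr Tᵢ²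
  -- = 2v`.
  estimate :=
    let d := (Real.sqrt (transverseVar n k))⁻¹
    ![EuclideanSpace.single 0 d, EuclideanSpace.single 0 (-d),
      EuclideanSpace.single 1 d, EuclideanSpace.single 1 (-d)]

theorem tangentEstimator_expect (n : ℕ) (k : Fin (n + 1)) (hn : 1 ≤ n) (i : Fin 2)
    (σ : Matrix (Fin (n + 1)) (Fin (n + 1)) ℂ) :
    (tangentEstimator n k hn).expect σ (fun x => (tangentEstimator n k hn).estimate x i) =
      (2 * transverseVar n k)⁻¹ * (σ * tangent n k i).trace.re := by
  have hv := transverseVar_pos n k hn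
  have h1 : Real.sqrt (transverseVar n k) * Real.sqrt (transverseVar n k) = transverseVar n k :=
    Real.mul_self_sqrt hv.le
  change ∑ x : Fin 4, _ = _
  rw [Fin.sum_univ_four]
  have e : (2 * transverseVar n k)⁻¹ = 1 / 2 * ((Real.sqrt (transverseVar n k))⁻¹ *
      (Real.sqrt (transverseVar n k))⁻¹) := by
    rw [← mul_inv, h1, mul_inv]; norm_num
  rw [e]
  fin_cases i <;>
  · simp [tangentEstimator, unitTangent, Matrix.mul_add, Matrix.trace_add]
    ring

theorem tangentEstimator_locallyUnbiased (n : ℕ) (k : Fin (n + 1)) (hn : 1 ≤ n) :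
    (tangentEstimator n k hn).LocallyUnbiased (model n (dicke n k)) 0 := by
  have hv := transverseVar_pos n k hn
  constructor
  · intro i
    rw [tangentEstimator_expect, model_zero, Matrix.trace_mul_comm, trace_mul_dicke, tangent,
      Matrix.smul_apply, Matrix.sub_apply]
    have h1 : (generator n i * dicke n k) k k = 0 := by
      rw [dicke, Matrix.mul_single_apply_same, generator_apply_self, zero_mul]
    have h2 : (dicke n k * generator n i) k k = 0 := by
      rw [dicke, Matrix.single_mul_apply_same, generator_apply_self, mul_zero]
    rw [h1, h2]; simp
  · intro i j
    simp only [tangentEstimator_expect]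
    let φ : Matrix (Fin (n + 1)) (Fin (n + 1)) ℂ →ₗ[ℝ] ℝ :=
      { toFun := fun A => (2 * transverseVar n k)⁻¹ * (A * tangent n k i).trace.re
        map_add' := fun A B => by rw [Matrix.add_mul, Matrix.trace_add, Complex.add_re, mul_add]
        map_smul' := fun c A => by
          rw [Matrix.smul_mul, Matrix.trace_smul, Complex.smul_re, RingHom.id_apply, smul_eq_mul,
            smul_eq_mul]
          ring }
    have h := hasDerivAt_linearMap_model n k φ j
    refine h.congr_deriv ?_
    change (2 * transverseVar n k)⁻¹ * (tangent n k j * tangent n k i).trace.re = _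
    rw [trace_tangent_mul_tangent]
    by_cases hij : i = j
    · subst hij
      simp only [if_true]
      rw [show (2 : ℂ) * (transverseVar n k : ℂ) = ((2 * transverseVar n k : ℝ) : ℂ) by push_cast; rfl,
        Complex.ofReal_re, inv_mul_cancel₀ (by positivity)]
    · simp [hij, Ne.symm hij]

/-- At the probe itself the tangents have mean zero, so all four outcomes have probability `1/4`,
each with squared error `1/v`. -/
theorem trace_mse_tangentEstimator (n : ℕ) (k : Fin (n + 1)) (hn : 1 ≤ n) :
    (1 * (tangentEstimator n k hn).mse (model n (dicke n k)) 0).trace =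
      (transverseVar n k)⁻¹ := by
  have hv := transverseVar_pos n k hn
  have h1 : Real.sqrt (transverseVar n k) * Real.sqrt (transverseVar n k) = transverseVar n k :=
    Real.mul_self_sqrt hv.le
  rw [Matrix.one_mul, Matrix.trace_fin_two]
  simp only [LocalEstimator.mse, Matrix.of_apply, model_zero, LocalEstimator.expect]
  change ∑ x : Fin 4, _ + ∑ x : Fin 4, _ = _
  rw [Fin.sum_univ_four, Fin.sum_univ_four]
  nth_rw 1 [← h1]
  simp [tangentEstimator, unitTangent, Matrix.mul_add, Matrix.trace_add, trace_dicke]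
  ring

theorem tightCR_dicke_le (n : ℕ) (k : Fin (n + 1)) (hn : 1 ≤ n) :
    tightCR (model n (dicke n k)) 0 1 ≤ ENNReal.ofReal (transverseVar n k)⁻¹ := by
  rw [← trace_mse_tangentEstimator n k hn]
  exact iInf₂_le (tangentEstimator n k hn) (tangentEstimator_locallyUnbiased n k hn)

theorem tightCR_dicke_le_div_sq {c : ℝ} (hc : c < 1 / 2) (n : ℕ) (k : Fin (n + 1)) (hn : 1 ≤ n)
    (hk : |wt n k| ≤ c * n) :
    tightCR (model n (dicke n k)) 0 1 ≤ ENNReal.ofReal (2 / (1 / 4 - c ^ 2) / (n : ℝ) ^ 2) := by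
  have hn' : (1 : ℝ) ≤ n := by exact_mod_cast hn
  refine (tightCR_dicke_le n k hn).trans (ENNReal.ofReal_le_ofReal ?_)
  -- `c < 1/2` alone does not bound `c²`; the inequality `|a| ≤ cn` excludes negative `c`.
  have hc0 : 0 ≤ c := by
    by_contra h
    nlinarith [abs_nonneg (wt n k)]
  have h2 : wt n k ^ 2 ≤ (c * n) ^ 2 := by
    rw [← sq_abs (wt n k)]
    exact pow_le_pow_left₀ (abs_nonneg _) hk 2
  have h3 : 0 < 1 / 4 - c ^ 2 := by nlinarith
  have h4 : 2 / (1 / 4 - c ^ 2) / (n : ℝ) ^ 2 = ((1 / 4 - c ^ 2) * (n : ℝ) ^ 2 / 2)⁻¹ := by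
    field_simp
  rw [h4]
  apply inv_anti₀ (by positivity)
  rw [transverseVar]
  nlinarith

/-! ### Rotations about the second axis -/

/-- The real matrix of `exp(i β J₂)`. -/
def rotR (n : ℕ) (β : ℝ) : Matrix (Fin (n + 1)) (Fin (n + 1)) ℝ :=
  NormedSpace.exp (β • realIJ2 n)

theorem realIJ2_transpose (n : ℕ) : (realIJ2 n)ᵀ = -realIJ2 n := by
  rw [realIJ2, Matrix.transpose_smul, Matrix.transpose_sub, Matrix.transpose_transpose, ← smul_neg,
    neg_sub]

theorem rotR_transpose (n : ℕ) (β : ℝ) : (rotR n β)ᵀ = rotR n (-β) := by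
  rw [rotR, ← Matrix.exp_transpose, Matrix.transpose_smul, realIJ2_transpose, rotR, smul_neg,
    neg_smul]

theorem rotR_mul_rotR_neg (n : ℕ) (β : ℝ) : rotR n β * rotR n (-β) = 1 := by
  rw [rotR, rotR, ← Matrix.exp_add_of_commute]
  · simp
  · exact ((Commute.refl _).smul_left _).smul_right _

theorem rotR_mul_transpose (n : ℕ) (β : ℝ) : rotR n β * (rotR n β)ᵀ = 1 := by
  rw [rotR_transpose, rotR_mul_rotR_neg]

theorem rotR_transpose_mul (n : ℕ) (β : ℝ) : (rotR n β)ᵀ * rotR n β = 1 := by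
  rw [rotR_transpose]
  simpa using rotR_mul_rotR_neg n (-β)

open scoped Matrix.Norms.Operator in
theorem hasDerivAt_rotR_apply (n : ℕ) (β : ℝ) (r s : Fin (n + 1)) :
    HasDerivAt (fun t => rotR n t r s) ((realIJ2 n * rotR n β) r s) β :=
  (LinearMap.toContinuousLinearMap (Matrix.entryLinearMap ℝ ℝ r s)).hasFDerivAt.comp_hasDerivAt β
    (hasDerivAt_exp_smul_const' (realIJ2 n) β)

theorem continuous_rotR_apply (n : ℕ) (r s : Fin (n + 1)) : Continuous fun t => rotR n t r s :=
  continuous_iff_continuousAt.mpr fun β => (hasDerivAt_rotR_apply n β r s).continuousAt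

-- The rotation turns `J₃` within the plane of `J₃` and `J₁`. Rotating the claimed right-hand side
-- back gives a function of the angle with zero derivative and value `J₃` at `0`.
open scoped Matrix.Norms.Operator in
theorem rotR_mul_realJ3 (n : ℕ) (β : ℝ) : rotR n β * realJ3 n =
    (Real.cos β • realJ3 n - Real.sin β • realJ1 n) * rotR n β := by
  let f : ℝ → Matrix (Fin (n + 1)) (Fin (n + 1)) ℝ := fun t =>
    NormedSpace.exp (t • -realIJ2 n) * (Real.cos t • realJ3 n - Real.sin t • realJ1 n) *
      NormedSpace.exp (t • realIJ2 n)
  have hf : ∀ t, HasDerivAt f 0 t := by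
    intro t
    have h1 := hasDerivAt_exp_smul_const (-realIJ2 n) t
    have h2 := hasDerivAt_exp_smul_const' (realIJ2 n) t
    have h3 := ((Real.hasDerivAt_cos t).smul_const (realJ3 n)).sub
      ((Real.hasDerivAt_sin t).smul_const (realJ1 n))
    refine ((h1.mul h3).mul h2).congr_deriv ?_
    have e1 : realJ3 n * realIJ2 n = realIJ2 n * realJ3 n + realJ1 n :=
      sub_eq_iff_eq_add'.mp (realJ3_comm_realIJ2 n)
    have e2 : realIJ2 n * realJ1 n = realJ1 n * realIJ2 n + realJ3 n :=
      sub_eq_iff_eq_add'.mp (realIJ2_comm_realJ1 n)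
    have e3 : NormedSpace.exp (t • -realIJ2 n) * -realIJ2 n *
          (Real.cos t • realJ3 n - Real.sin t • realJ1 n) +
          NormedSpace.exp (t • -realIJ2 n) * (-Real.sin t • realJ3 n - Real.cos t • realJ1 n) +
          NormedSpace.exp (t • -realIJ2 n) * (Real.cos t • realJ3 n - Real.sin t • realJ1 n) *
            realIJ2 n = 0 := by
      rw [Matrix.mul_assoc, Matrix.mul_assoc, ← Matrix.mul_add, ← Matrix.mul_add]
      simp only [Matrix.neg_mul, Matrix.mul_sub, Matrix.sub_mul, Matrix.mul_smul, Matrix.smul_mul,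
        e1, e2]
      convert Matrix.mul_zero _
      module
    simp only [Pi.sub_apply, Pi.mul_apply]
    rw [← Matrix.mul_assoc, ← Matrix.add_mul]
    exact (congrArg (fun A => A * NormedSpace.exp (t • realIJ2 n)) e3).trans (Matrix.zero_mul _)
  have hc := is_const_of_deriv_eq_zero (fun t => (hf t).differentiableAt) (fun t => (hf t).deriv) β 0
  have h0 : f 0 = realJ3 n := by simp [f]
  have hβ : f β = rotR n (-β) * (Real.cos β • realJ3 n - Real.sin β • realJ1 n) * rotR n β := by
    simp only [f, rotR, smul_neg, neg_smul]
  rw [h0, hβ] at hc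
  conv_lhs => rw [← hc, ← Matrix.mul_assoc, ← Matrix.mul_assoc, rotR_mul_rotR_neg, Matrix.one_mul]

/-! ### The Wigner functions `ψ_r(β) = ⟨r| exp(i β J₂) |k⟩` and their moments -/

theorem raiseR_mul_apply {n : ℕ} {r s : Fin (n + 1)} (h : (s : ℕ) = r + 1)
    (A : Matrix (Fin (n + 1)) (Fin (n + 1)) ℝ) (k : Fin (n + 1)) :
    (raiseR n * A) s k = ladder n r * A r k := by
  rw [Matrix.mul_apply, Finset.sum_eq_single r]
  · simp [raiseR, h]
  · intro b _ hb
    rw [raiseR, Matrix.of_apply, if_neg, zero_mul]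
    intro h'; apply hb; ext; omega
  · simp

theorem raiseR_transpose_mul_apply {n : ℕ} {r s : Fin (n + 1)} (h : (s : ℕ) = r + 1)
    (A : Matrix (Fin (n + 1)) (Fin (n + 1)) ℝ) (k : Fin (n + 1)) :
    ((raiseR n)ᵀ * A) r k = ladder n r * A s k := by
  rw [Matrix.mul_apply, Finset.sum_eq_single s]
  · simp [raiseR, h]
  · intro b _ hb
    rw [Matrix.transpose_apply, raiseR, Matrix.of_apply, if_neg, zero_mul]
    intro h'; apply hb; ext; omega
  · simp

theorem realJ1_add_realIJ2 (n : ℕ) : realJ1 n + realIJ2 n = raiseR n := by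
  rw [realJ1, realIJ2]; module

theorem realJ1_sub_realIJ2 (n : ℕ) : realJ1 n - realIJ2 n = (raiseR n)ᵀ := by
  rw [realJ1, realIJ2]; module

/-- Column `k` of the rotation is an eigenvector of the rotated `J₃` with eigenvalue `a`. -/
theorem wt_mul_rotR (n : ℕ) (k r : Fin (n + 1)) (β : ℝ) : wt n k * rotR n β r k =
    Real.cos β * wt n r * rotR n β r k - Real.sin β * (realJ1 n * rotR n β) r k := by
  have h := congrFun (congrFun (rotR_mul_realJ3 n β) r) k
  rw [realJ3, Matrix.mul_diagonal, Matrix.sub_mul, Matrix.sub_apply, Matrix.smul_mul,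
    Matrix.smul_mul, Matrix.smul_apply, Matrix.smul_apply, Matrix.diagonal_mul, smul_eq_mul,
    smul_eq_mul] at h
  linarith

/-- Since `ψ' = (iJ₂)ψ`, replacing `J₁` by `J₊ - iJ₂` in the eigenvector equation yields a
first-order relation between neighbouring Wigner functions. The lowering version is `sin_mul_lower`.
-/
theorem sin_mul_raise (n : ℕ) (k : Fin (n + 1)) {r s : Fin (n + 1)} (h : (s : ℕ) = r + 1) (β : ℝ) :
    Real.sin β * (ladder n r * rotR n β r k) = Real.sin β * (realIJ2 n * rotR n β) s k +
      (wt n s * Real.cos β - wt n k) * rotR n β s k := by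
  rw [← raiseR_mul_apply h, ← realJ1_add_realIJ2, Matrix.add_mul, Matrix.add_apply]
  have := wt_mul_rotR n k s β
  linarith

theorem sin_mul_lower (n : ℕ) (k : Fin (n + 1)) {r s : Fin (n + 1)} (h : (s : ℕ) = r + 1) (β : ℝ) :
    Real.sin β * (ladder n r * rotR n β s k) = -(Real.sin β * (realIJ2 n * rotR n β) r k) +
      (wt n r * Real.cos β - wt n k) * rotR n β r k := by
  rw [← raiseR_transpose_mul_apply h, ← realJ1_sub_realIJ2, Matrix.sub_mul, Matrix.sub_apply]
  have := wt_mul_rotR n k r β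
  linarith

theorem wt_succ {n : ℕ} {r s : Fin (n + 1)} (h : (s : ℕ) = r + 1) : wt n s = wt n r + 1 := by
  rw [wt, wt, h]; push_cast; ring

theorem ladder_pos_of_succ {n : ℕ} {r s : Fin (n + 1)} (h : (s : ℕ) = r + 1) :
    0 < ladder n r := ladder_pos (by omega)

/-- The two ladder relations combine, with `a` cancelling, to make the difference of the integrands
an exact derivative: that of a multiple of `sin β ψ_r ψ_s`, which vanishes at both ends. -/
theorem integral_sin_mul_sq_succ (n : ℕ) (k : Fin (n + 1)) {r s : Fin (n + 1)}
    (h : (s : ℕ) = r + 1) :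
    ∫ β in (0 : ℝ)..Real.pi, Real.sin β * rotR n β s k ^ 2 =
      ∫ β in (0 : ℝ)..Real.pi, Real.sin β * rotR n β r k ^ 2 := by
  have c1 := continuous_rotR_apply n r k
  have c2 := continuous_rotR_apply n s k
  rw [← sub_eq_zero, ← intervalIntegral.integral_sub
    (by apply Continuous.intervalIntegrable; fun_prop)
    (by apply Continuous.intervalIntegrable; fun_prop)]
  have hd : ∀ β ∈ Set.uIcc 0 Real.pi, HasDerivAt
      (fun β => -(ladder n r)⁻¹ * (Real.sin β * (rotR n β r k * rotR n β s k)))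
      (Real.sin β * rotR n β s k ^ 2 - Real.sin β * rotR n β r k ^ 2) β := by
    intro β _
    refine (((Real.hasDerivAt_sin β).mul ((hasDerivAt_rotR_apply n β r k).mul
      (hasDerivAt_rotR_apply n β s k))).const_mul _).congr_deriv ?_
    have h1 := sin_mul_raise n k h β
    have h2 := sin_mul_lower n k h β
    rw [wt_succ h] at h1
    have hl := (ladder_pos_of_succ h).ne'
    field_simp
    simp only [Pi.mul_apply]
    linear_combination rotR n β r k * h1 - rotR n β s k * h2
  rw [intervalIntegral.integral_eq_sub_of_hasDerivAt hd
    (by apply Continuous.intervalIntegrable; fun_prop)]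
  simp

/-- Same mechanism with the primitive `-cos β sin β ψ_r ψ_s`; differentiating the cosine produces
the off-diagonal moment. -/
theorem integral_sin_cos_mul_sq_succ (n : ℕ) (k : Fin (n + 1)) {r s : Fin (n + 1)}
    (h : (s : ℕ) = r + 1) :
    ladder n r * ((∫ β in (0 : ℝ)..Real.pi, Real.sin β * Real.cos β * rotR n β s k ^ 2) -
      ∫ β in (0 : ℝ)..Real.pi, Real.sin β * Real.cos β * rotR n β r k ^ 2) =
      -∫ β in (0 : ℝ)..Real.pi, Real.sin β ^ 2 * (rotR n β r k * rotR n β s k) := by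
  have c1 := continuous_rotR_apply n r k
  have c2 := continuous_rotR_apply n s k
  rw [← intervalIntegral.integral_sub
    (by apply Continuous.intervalIntegrable; fun_prop)
    (by apply Continuous.intervalIntegrable; fun_prop), ← intervalIntegral.integral_const_mul,
    ← sub_eq_zero, sub_neg_eq_add, ← intervalIntegral.integral_add
    (by apply Continuous.intervalIntegrable; fun_prop)
    (by apply Continuous.intervalIntegrable; fun_prop)]
  have hd : ∀ β ∈ Set.uIcc 0 Real.pi, HasDerivAt
      (fun β => -(Real.cos β * (Real.sin β * (rotR n β r k * rotR n β s k))))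
      (ladder n r * (Real.sin β * Real.cos β * rotR n β s k ^ 2 -
        Real.sin β * Real.cos β * rotR n β r k ^ 2) +
        Real.sin β ^ 2 * (rotR n β r k * rotR n β s k)) β := by
    intro β _
    refine (((Real.hasDerivAt_cos β).mul ((Real.hasDerivAt_sin β).mul
      ((hasDerivAt_rotR_apply n β r k).mul (hasDerivAt_rotR_apply n β s k)))).neg).congr_deriv ?_
    have h1 := sin_mul_raise n k h β
    have h2 := sin_mul_lower n k h β
    rw [wt_succ h] at h1
    simp only [Pi.mul_apply]
    linear_combination Real.cos β * (rotR n β r k * h1 - rotR n β s k * h2)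
  rw [intervalIntegral.integral_eq_sub_of_hasDerivAt hd
    (by apply Continuous.intervalIntegrable; fun_prop)]
  simp

/-- The primitive is `sin² β ψ_r ψ_t`; the weight gap `2` between `t` and `r` absorbs the derivative
of `sin²`. -/
theorem integral_sin_sq_mul_succ (n : ℕ) (k : Fin (n + 1)) {r s t : Fin (n + 1)}
    (h : (s : ℕ) = r + 1) (h' : (t : ℕ) = s + 1) :
    ladder n s * ∫ β in (0 : ℝ)..Real.pi, Real.sin β ^ 2 * (rotR n β r k * rotR n β s k) =
      ladder n r * ∫ β in (0 : ℝ)..Real.pi, Real.sin β ^ 2 * (rotR n β s k * rotR n β t k) := by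
  have c1 := continuous_rotR_apply n r k
  have c2 := continuous_rotR_apply n s k
  have c3 := continuous_rotR_apply n t k
  rw [← intervalIntegral.integral_const_mul, ← intervalIntegral.integral_const_mul,
    ← sub_eq_zero, ← intervalIntegral.integral_sub
    (by apply Continuous.intervalIntegrable; fun_prop)
    (by apply Continuous.intervalIntegrable; fun_prop)]
  have hd : ∀ β ∈ Set.uIcc 0 Real.pi, HasDerivAt
      (fun β => Real.sin β * Real.sin β * (rotR n β r k * rotR n β t k))
      (ladder n s * (Real.sin β ^ 2 * (rotR n β r k * rotR n β s k)) -
        ladder n r * (Real.sin β ^ 2 * (rotR n β s k * rotR n β t k))) β := by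
    intro β _
    refine (((Real.hasDerivAt_sin β).mul (Real.hasDerivAt_sin β)).mul
      ((hasDerivAt_rotR_apply n β r k).mul (hasDerivAt_rotR_apply n β t k))).congr_deriv ?_
    have h1 := sin_mul_raise n k h' β
    have h2 := sin_mul_lower n k h β
    rw [wt_succ h', wt_succ h] at h1
    simp only [Pi.mul_apply]
    linear_combination Real.sin β * (rotR n β t k * h2 - rotR n β r k * h1)
  rw [intervalIntegral.integral_eq_sub_of_hasDerivAt hd
    (by apply Continuous.intervalIntegrable; fun_prop)]
  simp

/-! ### Traces of the generators and evaluation of the moments -/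

theorem trace_realJ3 (n : ℕ) : (realJ3 n).trace = 0 := by
  rw [← realIJ2_comm_realJ1, Matrix.trace_sub, Matrix.trace_mul_comm, sub_self]

theorem sum_wt (n : ℕ) : ∑ r, wt n r = 0 := by
  rw [← trace_realJ3 n, realJ3, Matrix.trace_diagonal]

/-- Each generator is a commutator of the other two, so cyclicity of the trace identifies the
squares. -/
theorem trace_realJ1_sq (n : ℕ) :
    (realJ1 n * realJ1 n).trace = (realJ3 n * realJ3 n).trace := by
  have h1 : (realJ1 n * realJ1 n).trace =
      (realJ1 n * (realJ3 n * realIJ2 n - realIJ2 n * realJ3 n)).trace := by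
    rw [realJ3_comm_realIJ2]
  have h2 : (realJ3 n * realJ3 n).trace =
      ((realIJ2 n * realJ1 n - realJ1 n * realIJ2 n) * realJ3 n).trace := by
    rw [realIJ2_comm_realJ1]
  rw [h1, h2, Matrix.mul_sub, Matrix.sub_mul, Matrix.trace_sub, Matrix.trace_sub,
    ← Matrix.mul_assoc, Matrix.trace_mul_comm, ← Matrix.mul_assoc, ← Matrix.mul_assoc]

theorem trace_realIJ2_sq (n : ℕ) :
    (realIJ2 n * realIJ2 n).trace = -(realJ3 n * realJ3 n).trace := by
  have h1 : (realIJ2 n * realIJ2 n).trace =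
      (realIJ2 n * (realJ3 n * realJ1 n - realJ1 n * realJ3 n)).trace := by
    rw [realJ3_comm_realJ1]
  have h2 : (realJ3 n * realJ3 n).trace =
      ((realIJ2 n * realJ1 n - realJ1 n * realIJ2 n) * realJ3 n).trace := by
    rw [realIJ2_comm_realJ1]
  rw [h1, h2, Matrix.mul_sub, Matrix.sub_mul, Matrix.trace_sub, Matrix.trace_sub,
    ← Matrix.mul_assoc, Matrix.trace_mul_comm, ← Matrix.mul_assoc, ← Matrix.mul_assoc, neg_sub]

theorem trace_realJ3_sq_add (n : ℕ) :
    (realJ3 n * realJ3 n).trace + 2 * (realJ1 n * realJ1 n).trace =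
      (n : ℝ) / 2 * (n / 2 + 1) * (n + 1) := by
  have h := congrArg Matrix.trace (realCasimir n)
  rw [Matrix.trace_add, Matrix.trace_sub, trace_realIJ2_sq, trace_realJ1_sq, Matrix.trace_smul,
    Matrix.trace_one, Fintype.card_fin, smul_eq_mul] at h
  rw [trace_realJ1_sq]
  push_cast at h
  linarith

theorem sum_rotR_sq (n : ℕ) (k : Fin (n + 1)) (β : ℝ) : ∑ r, rotR n β r k ^ 2 = 1 := by
  have h := congrFun (congrFun (rotR_transpose_mul n β) k) k
  rw [Matrix.mul_apply, Matrix.one_apply_eq] at h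
  rw [← h]
  exact Finset.sum_congr rfl fun r _ => by rw [Matrix.transpose_apply, pow_two]

theorem eq_of_succ_eq {n : ℕ} {f : Fin (n + 1) → ℝ} {c : ℝ}
    (h : ∀ r s : Fin (n + 1), (s : ℕ) = r + 1 → f s = f r + c) (r : Fin (n + 1)) :
    f r = f 0 + c * (r : ℕ) := by
  obtain ⟨r, hr⟩ := r
  induction r with
  | zero => simp
  | succ r ih =>
    rw [h ⟨r, by omega⟩ ⟨r + 1, hr⟩ rfl, ih (by omega)]
    push_cast; ring

/-- Schur's lemma in coordinates: all rows have the same integral, and by normalization of the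
column they sum to `∫ sin = 2`. -/
theorem integral_sin_mul_sq (n : ℕ) (k r : Fin (n + 1)) :
    ∫ β in (0 : ℝ)..Real.pi, Real.sin β * rotR n β r k ^ 2 = 2 / ((n : ℝ) + 1) := by
  have hc : ∀ r, ∫ β in (0 : ℝ)..Real.pi, Real.sin β * rotR n β r k ^ 2 =
      ∫ β in (0 : ℝ)..Real.pi, Real.sin β * rotR n β 0 k ^ 2 := fun r => by
    have := eq_of_succ_eq (c := 0)
      (f := fun r => ∫ β in (0 : ℝ)..Real.pi, Real.sin β * rotR n β r k ^ 2)
      (fun r s h => by rw [add_zero]; exact integral_sin_mul_sq_succ n k h) r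
    simpa using this
  have hs : ∑ r, ∫ β in (0 : ℝ)..Real.pi, Real.sin β * rotR n β r k ^ 2 = 2 := by
    rw [← intervalIntegral.integral_finsetSum]
    · simp_rw [← Finset.mul_sum, sum_rotR_sq]
      simp; norm_num
    · intro r _
      have c1 := continuous_rotR_apply n r k
      apply Continuous.intervalIntegrable; fun_prop
  rw [hc]
  simp_rw [hc] at hs
  rw [Finset.sum_const, Finset.card_univ, Fintype.card_fin, nsmul_eq_mul] at hs
  push_cast at hs
  rw [eq_div_iff (by positivity), mul_comm, hs]

/-- The proportionality constant of the vector operator obtained by averaging a rotated Dicke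
state. -/
def vectorCoeff (n : ℕ) (k : Fin (n + 1)) : ℝ :=
  wt n k / ((n : ℝ) / 2 * (n / 2 + 1) * (n + 1))

/-- Wigner–Eckart in coordinates: the recursions force the moments to be proportional to the entries
of `J₁` and `J₃`, with one common constant. -/
theorem exists_vector_moments (n : ℕ) (hn : 1 ≤ n) (k : Fin (n + 1)) : ∃ κ : ℝ,
    (∀ r s : Fin (n + 1), (s : ℕ) = r + 1 →
      ∫ β in (0 : ℝ)..Real.pi, Real.sin β ^ 2 * (rotR n β r k * rotR n β s k) =
        -κ * ladder n r) ∧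
    ∀ r, ∫ β in (0 : ℝ)..Real.pi, Real.sin β * Real.cos β * rotR n β r k ^ 2 = κ * wt n r := by
  let K : Fin (n + 1) → Fin (n + 1) → ℝ := fun r s =>
    ∫ β in (0 : ℝ)..Real.pi, Real.sin β ^ 2 * (rotR n β r k * rotR n β s k)
  let I : Fin (n + 1) → ℝ := fun r =>
    ∫ β in (0 : ℝ)..Real.pi, Real.sin β * Real.cos β * rotR n β r k ^ 2
  let κ : ℝ := -(K ⟨0, by omega⟩ ⟨1, by omega⟩) / ladder n 0
  have h0 : ladder n 0 ≠ 0 := (ladder_pos (by omega)).ne'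
  have hK : ∀ (m : ℕ) (hm : m + 1 < n + 1), K ⟨m, by omega⟩ ⟨m + 1, hm⟩ = -κ * ladder n m := by
    intro m
    induction m with
    | zero => intro hm; simp only [κ]; field_simp
    | succ m ih =>
      intro hm
      have h1 : ladder n (m + 1) * K ⟨m, by omega⟩ ⟨m + 1, by omega⟩ =
          ladder n m * K ⟨m + 1, by omega⟩ ⟨m + 1 + 1, by omega⟩ :=
        integral_sin_sq_mul_succ n k (r := ⟨m, by omega⟩)
        (s := ⟨m + 1, by omega⟩) (t := ⟨m + 1 + 1, hm⟩) rfl rfl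
      rw [ih (by omega)] at h1
      have h2 : ladder n m ≠ 0 := (ladder_pos (by omega)).ne'
      apply mul_left_cancel₀ h2
      rw [← h1]; ring
  have hK' : ∀ r s : Fin (n + 1), (s : ℕ) = r + 1 → K r s = -κ * ladder n r := by
    rintro ⟨r, hr⟩ ⟨s, hs⟩ h
    simp only at h
    subst h
    exact hK r hs
  refine ⟨κ, hK', ?_⟩
  have hI : ∀ r, I r = I 0 + κ * (r : ℕ) := by
    refine eq_of_succ_eq fun r s h => ?_
    have h1 : ladder n r * (I s - I r) = -K r s := integral_sin_cos_mul_sq_succ n k h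
    have h2 := (ladder_pos_of_succ h).ne'
    rw [hK' r s h] at h1
    have h3 : I s - I r = κ := mul_left_cancel₀ h2 (by rw [h1]; ring)
    linarith
  have hI' : ∀ r, I r = (I 0 + κ * ((n : ℝ) / 2)) + κ * wt n r := by
    intro r; rw [hI, wt]; ring
  -- The additive constant in `I` disappears because both `∫ sin cos` and the sum of the weights
  -- vanish.
  have hs : ∑ r, I r = 0 := by
    simp only [I]
    rw [← intervalIntegral.integral_finsetSum]
    · simp_rw [← Finset.mul_sum, sum_rotR_sq, mul_one]
      rw [integral_sin_mul_cos₁, Real.sin_pi, Real.sin_zero]; norm_num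
    · intro r _
      have c1 := continuous_rotR_apply n r k
      apply Continuous.intervalIntegrable; fun_prop
  rw [Finset.sum_congr rfl fun r _ => hI' r] at hs
  rw [Finset.sum_add_distrib, ← Finset.mul_sum, sum_wt, mul_zero, add_zero, Finset.sum_const,
    Finset.card_univ, Fintype.card_fin, nsmul_eq_mul] at hs
  have hd := (mul_eq_zero.mp hs).resolve_left (by positivity)
  intro r
  change I r = _
  rw [hI', hd, zero_add]

/-- The constant comes from integrating the mean of the rotated `J₃` in its own eigenvector against
`sin β`: this gives `2a = κ (Tr J₃² + 2 Tr J₁²)`, and the Casimir evaluates the bracket. -/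
theorem vector_moments (n : ℕ) (hn : 1 ≤ n) (k : Fin (n + 1)) :
    (∀ r s : Fin (n + 1), (s : ℕ) = r + 1 →
      ∫ β in (0 : ℝ)..Real.pi, Real.sin β ^ 2 * (rotR n β r k * rotR n β s k) =
        -(2 * vectorCoeff n k) * ladder n r) ∧
    ∀ r, ∫ β in (0 : ℝ)..Real.pi, Real.sin β * Real.cos β * rotR n β r k ^ 2 =
      2 * vectorCoeff n k * wt n r := by
  obtain ⟨κ, hK, hI⟩ := exists_vector_moments n hn k
  suffices h : κ = 2 * vectorCoeff n k by rw [← h]; exact ⟨hK, hI⟩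
  have hX : ∀ r s, realJ1 n r s *
      ∫ β in (0 : ℝ)..Real.pi, Real.sin β ^ 2 * (rotR n β r k * rotR n β s k) =
      -κ * (2 * (realJ1 n r s * realJ1 n s r)) := by
    intro r s
    by_cases h1 : (r : ℕ) = s + 1
    · have h2 : (s : ℕ) ≠ r + 1 := by omega
      have e : ∀ β, rotR n β r k * rotR n β s k = rotR n β s k * rotR n β r k := fun β => mul_comm _ _
      simp_rw [e]
      rw [hK s r h1]
      simp [realJ1, raiseR, h1, show ¬(s : ℕ) = s + 1 + 1 by omega]
      ring
    · by_cases h2 : (s : ℕ) = r + 1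
      · rw [hK r s h2]
        simp [realJ1, raiseR, h2, show ¬(r : ℕ) = r + 1 + 1 by omega]
        ring
      · simp [realJ1, raiseR, h1, h2]
  have hpt : ∀ β, wt n k * Real.sin β =
      (∑ r, wt n r * (Real.sin β * Real.cos β * rotR n β r k ^ 2)) -
      ∑ r, ∑ s, realJ1 n r s * (Real.sin β ^ 2 * (rotR n β r k * rotR n β s k)) := by
    intro β
    have h1 : ∀ r, Real.sin β * rotR n β r k * (wt n k * rotR n β r k) =
        wt n r * (Real.sin β * Real.cos β * rotR n β r k ^ 2) -
        ∑ s, realJ1 n r s * (Real.sin β ^ 2 * (rotR n β r k * rotR n β s k)) := by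
      intro r
      rw [wt_mul_rotR, Matrix.mul_apply, mul_sub, Finset.mul_sum, Finset.mul_sum]
      congr 1
      · ring
      · exact Finset.sum_congr rfl fun s _ => by ring
    rw [← Finset.sum_sub_distrib, ← Finset.sum_congr rfl fun r _ => h1 r]
    calc wt n k * Real.sin β = wt n k * Real.sin β * ∑ r, rotR n β r k ^ 2 := by
          rw [sum_rotR_sq, mul_one]
      _ = _ := by
          rw [Finset.mul_sum]
          exact Finset.sum_congr rfl fun r _ => by ring
  have hint : ∫ β in (0 : ℝ)..Real.pi, wt n k * Real.sin β = wt n k * 2 := by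
    rw [intervalIntegral.integral_const_mul]; simp; norm_num
  have hc := continuous_rotR_apply n
  simp_rw [hpt] at hint
  rw [intervalIntegral.integral_sub
    (by apply Continuous.intervalIntegrable; fun_prop)
    (by apply Continuous.intervalIntegrable; fun_prop),
    intervalIntegral.integral_finsetSum
    (fun r _ => by apply Continuous.intervalIntegrable; fun_prop),
    intervalIntegral.integral_finsetSum
    (fun r _ => by apply Continuous.intervalIntegrable; fun_prop)] at hint
  simp_rw [intervalIntegral.integral_const_mul, hI] at hint
  have e1 : ∀ r, ∫ β in (0 : ℝ)..Real.pi,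
      ∑ s, realJ1 n r s * (Real.sin β ^ 2 * (rotR n β r k * rotR n β s k)) =
      -κ * (2 * (realJ1 n * realJ1 n) r r) := by
    intro r
    rw [intervalIntegral.integral_finsetSum
      (fun r _ => by apply Continuous.intervalIntegrable; fun_prop)]
    simp_rw [intervalIntegral.integral_const_mul, hX]
    rw [← Finset.mul_sum, ← Finset.mul_sum, ← Matrix.mul_apply]
  simp_rw [e1] at hint
  have e2 : ∑ r, wt n r * (κ * wt n r) = κ * (realJ3 n * realJ3 n).trace := by
    rw [realJ3, Matrix.diagonal_mul_diagonal, Matrix.trace_diagonal, Finset.mul_sum]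
    exact Finset.sum_congr rfl fun r _ => by ring
  have e3 : ∑ r, -κ * (2 * (realJ1 n * realJ1 n) r r) = -κ * (2 * (realJ1 n * realJ1 n).trace) := by
    rw [← Finset.mul_sum, ← Finset.mul_sum]; rfl
  have hT := trace_realJ3_sq_add n
  have hn' : (1 : ℝ) ≤ n := by exact_mod_cast hn
  rw [e2, e3] at hint
  rw [vectorCoeff, ← mul_div_assoc, eq_div_iff (by positivity), ← hT]
  linarith

/-! ### Finite quadrature -/

/-- By Carathéodory the hull is the continuous image of a simplex times a power of `s`, with `dim +
1` points. -/
theorem isCompact_convexHull_of_isCompact {E : Type*} [NormedAddCommGroup E] [NormedSpace ℝ E]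
    [FiniteDimensional ℝ E] {s : Set E} (hs : IsCompact s) : IsCompact (convexHull ℝ s) := by
  rcases s.eq_empty_or_nonempty with rfl | ⟨p, hp⟩
  · simp
  let d := Module.finrank ℝ E + 1
  let f : (Fin d → ℝ) × (Fin d → E) → E := fun x => ∑ i, x.1 i • x.2 i
  have hf : Continuous f := by fun_prop
  have hc := ((isCompact_stdSimplex ℝ (Fin d)).prod (isCompact_univ_pi fun _ : Fin d => hs)).image hf
  convert hc using 1
  apply Set.Subset.antisymm
  · intro x hx
    obtain ⟨ι, _, z, w, hz, hi, hw, hw1, rfl⟩ := eq_pos_convex_span_of_mem_convexHull hx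
    have hcard : Fintype.card ι ≤ Fintype.card (Fin d) := by
      rw [Fintype.card_fin]
      exact hi.card_le_finrank_succ.trans (Nat.succ_le_succ (Submodule.finrank_le _))
    obtain ⟨e⟩ := Function.Embedding.nonempty_of_card_le hcard
    -- Shorter combinations are padded with weight `0` at an arbitrary point `p` of the set.
    refine ⟨(Function.extend e w 0, Function.extend e z fun _ => p), ⟨⟨fun i => ?_, ?_⟩, ?_⟩, ?_⟩
    · by_cases h : ∃ a, e a = i
      · obtain ⟨a, rfl⟩ := h
        simp only [e.injective.extend_apply]; exact (hw a).le
      · simp only [Function.extend_apply' _ _ _ h]; exact le_rfl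
    · rw [← hw1]
      refine (Fintype.sum_of_injective e e.injective _ _ (fun i h => ?_) fun a => ?_).symm
      · exact Function.extend_apply' _ _ _ h
      · exact (e.injective.extend_apply _ _ _).symm
    · intro i _
      by_cases h : ∃ a, e a = i
      · obtain ⟨a, rfl⟩ := h
        simp only [e.injective.extend_apply]; exact hz ⟨a, rfl⟩
      · simp only [Function.extend_apply' _ _ _ h]; exact hp
    · refine (Fintype.sum_of_injective e e.injective _ _ (fun i h => ?_) fun a => ?_).symm
      · have : ¬∃ a, e a = i := h
        simp [Function.extend_apply' _ _ _ this]
      · simp [e.injective.extend_apply]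
  · rintro _ ⟨⟨w, z⟩, ⟨hw, hz⟩, rfl⟩
    exact (convex_convexHull ℝ s).sum_mem (fun i _ => hw.1 i) hw.2
      fun i _ => subset_convexHull ℝ s (hz i (Set.mem_univ i))

/-- The mean of `F` under the probability density `sin β / 2` lies in the convex hull of the compact
curve `F([0, π])`, so finitely many nodes reproduce it exactly. -/
theorem exists_finite_quadrature {ι : Type*} [Fintype ι] {F : ℝ → ι → ℝ} (hF : Continuous F) :
    ∃ (κ : Type) (_ : Fintype κ) (w : κ → ℝ) (x : κ → ℝ), (∀ a, 0 ≤ w a) ∧ ∑ a, w a = 1 ∧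
      (∀ a, x a ∈ Set.Icc 0 Real.pi) ∧
      ∀ i, ∑ a, w a * F (x a) i = 1 / 2 * ∫ β in (0 : ℝ)..Real.pi, Real.sin β * F β i := by
  let ν : Measure ℝ := volume.restrict (Set.Ioc 0 Real.pi)
  let g : ℝ → NNReal := fun β => Real.toNNReal (Real.sin β / 2)
  have hg : Measurable g := by fun_prop
  let μ : Measure ℝ := ν.withDensity fun β => (g β : ℝ≥0∞)
  have hpos : ∀ᵐ β ∂ν, 0 ≤ Real.sin β / 2 := by
    refine (ae_restrict_iff' measurableSet_Ioc).mpr (Eventually.of_forall fun β hβ => ?_)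
    have := Real.sin_nonneg_of_nonneg_of_le_pi hβ.1.le hβ.2
    positivity
  have hint : ∫ β, Real.sin β / 2 ∂ν = 1 := by
    change ∫ β in Set.Ioc 0 Real.pi, Real.sin β / 2 = 1
    rw [← intervalIntegral.integral_of_le Real.pi_pos.le, intervalIntegral.integral_div]
    simp
  have hprob : IsProbabilityMeasure μ := by
    refine ⟨?_⟩
    rw [withDensity_apply _ MeasurableSet.univ, Measure.restrict_univ]
    change ∫⁻ β, ENNReal.ofReal (Real.sin β / 2) ∂ν = 1
    rw [← ofReal_integral_eq_lintegral_ofReal _ hpos, hint, ENNReal.ofReal_one]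
    exact (by fun_prop : Continuous fun β : ℝ => Real.sin β / 2).integrableOn_Ioc
  have hmem : ∀ᵐ β ∂μ, β ∈ Set.Ioc 0 Real.pi :=
    (withDensity_absolutelyContinuous ν _).ae_le (ae_restrict_mem measurableSet_Ioc)
  have hS : IsCompact (F '' Set.Icc 0 Real.pi) := isCompact_Icc.image hF
  obtain ⟨C, hC⟩ := hS.isBounded.exists_norm_le
  have hmem' : ∀ᵐ β ∂μ, F β ∈ F '' Set.Icc 0 Real.pi := by
    filter_upwards [hmem] with β hβ using ⟨β, ⟨hβ.1.le, hβ.2⟩, rfl⟩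
  have hFi : Integrable F μ :=
    Integrable.of_bound hF.aestronglyMeasurable C (hmem'.mono fun β h => hC _ h)
  have hm := (convex_convexHull ℝ (F '' Set.Icc 0 Real.pi)).integral_mem
    (isCompact_convexHull_of_isCompact hS).isClosed
    (hmem'.mono fun β h => subset_convexHull ℝ _ h) hFi
  obtain ⟨κ, hκ, w, z, hw, hw1, hz, hsum⟩ := mem_convexHull_iff_exists_fintype.mp hm
  choose x hx hxz using hz
  refine ⟨κ, hκ, w, x, hw, hw1, hx, fun i => ?_⟩
  have h1 := congrFun hsum i
  rw [Finset.sum_apply] at h1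
  simp only [Pi.smul_apply, smul_eq_mul, ← hxz] at h1
  rw [h1, integral_withDensity_eq_integral_smul hg]
  have hgi : Integrable (fun β => g β • F β) ν :=
    (integrable_withDensity_iff_integrable_smul hg).mp hFi
  rw [eval_integral fun j => hgi.eval j]
  rw [intervalIntegral.integral_of_le Real.pi_pos.le, ← integral_const_mul]
  refine integral_congr_ae ?_
  filter_upwards [hpos] with β hβ
  simp only [Pi.smul_apply, NNReal.smul_def, g, Real.coe_toNNReal _ hβ, smul_eq_mul]
  ring

/-! ### Polar coordinates on the parameter space -/

/-- The parameter `θ` with polar angle `β` and azimuth `φ`. -/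
def polar (β φ : ℝ) : EuclideanSpace ℝ (Fin 2) := !₂[β * Real.sin φ, β * Real.cos φ]

/-- The phase `exp(i φ)`. -/
def phase (φ : ℝ) : ℂ := Complex.exp (φ * Complex.I)

theorem phase_eq (φ : ℝ) : phase φ = Real.cos φ + Real.sin φ * Complex.I := by
  rw [phase, Complex.exp_mul_I]; push_cast; rfl

theorem star_phase (φ : ℝ) : star (phase φ) = Real.cos φ - Real.sin φ * Complex.I := by
  rw [phase_eq, star_add, star_mul', Complex.star_def, Complex.conj_ofReal, Complex.conj_ofReal,
    Complex.conj_I]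
  ring

theorem phase_mul_star (φ : ℝ) : phase φ * star (phase φ) = 1 := by
  rw [phase, Complex.star_def, Complex.mul_conj, Complex.normSq_eq_norm_sq,
    Complex.norm_exp_ofReal_mul_I]
  simp

theorem phase_pow_mul_star_pow (φ : ℝ) (m : ℕ) : phase φ ^ m * star (phase φ) ^ m = 1 := by
  rw [← mul_pow, phase_mul_star, one_pow]

theorem norm_polar {β : ℝ} (hβ : 0 ≤ β) (φ : ℝ) : ‖polar β φ‖ = β := by
  rw [polar, EuclideanSpace.norm_eq, Fin.sum_univ_two]
  have : ‖β * Real.sin φ‖ ^ 2 + ‖β * Real.cos φ‖ ^ 2 = β ^ 2 := by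
    rw [Real.norm_eq_abs, Real.norm_eq_abs, sq_abs, sq_abs]
    nlinarith [Real.sin_sq_add_cos_sq φ]
  simp only [Matrix.cons_val_zero, Matrix.cons_val_one]
  rw [this, Real.sqrt_sq hβ]

theorem exists_polar (θ : EuclideanSpace ℝ (Fin 2)) : ∃ φ, θ = polar ‖θ‖ φ := by
  let z : ℂ := ⟨θ 1, θ 0⟩
  have hz : ‖z‖ = ‖θ‖ := by
    rw [EuclideanSpace.norm_eq, Fin.sum_univ_two, Complex.norm_def, Complex.normSq_apply]
    simp only [Real.norm_eq_abs, sq_abs, z]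
    congr 1; ring
  refine ⟨z.arg, ?_⟩
  ext i
  fin_cases i
  · simp only [polar, ← hz]
    exact (Complex.norm_mul_sin_arg z).symm
  · simp only [polar, ← hz]
    exact (Complex.norm_mul_cos_arg z).symm

/-- The rotation about the third axis, up to a global phase. -/
def phaseMatrix (n : ℕ) (φ : ℝ) : Matrix (Fin (n + 1)) (Fin (n + 1)) ℂ :=
  Matrix.diagonal fun r => phase φ ^ (r : ℕ)

theorem phaseMatrix_mul_conjTranspose (n : ℕ) (φ : ℝ) :
    phaseMatrix n φ * (phaseMatrix n φ)ᴴ = 1 := by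
  rw [phaseMatrix, Matrix.diagonal_conjTranspose, Matrix.diagonal_mul_diagonal, ← Matrix.diagonal_one]
  congr 1
  ext r
  rw [Pi.star_apply, star_pow, phase_pow_mul_star_pow]

theorem phaseMatrix_conj_apply (n : ℕ) (φ : ℝ) (A : Matrix (Fin (n + 1)) (Fin (n + 1)) ℂ)
    (r s : Fin (n + 1)) : (phaseMatrix n φ * A * (phaseMatrix n φ)ᴴ) r s =
      phase φ ^ (r : ℕ) * A r s * star (phase φ) ^ (s : ℕ) := by
  rw [phaseMatrix, Matrix.diagonal_conjTranspose, Matrix.mul_diagonal, Matrix.diagonal_mul,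
    Pi.star_apply, star_pow]

/-- Conjugation multiplies the raising entries by `exp(iφ)` and the lowering ones by its conjugate.
-/
theorem phaseMatrix_conj_realIJ2 (n : ℕ) (φ : ℝ) :
    phaseMatrix n φ * complexify n (realIJ2 n) * (phaseMatrix n φ)ᴴ =
      Complex.I • ((Real.sin φ : ℂ) • J1 n + (Real.cos φ : ℂ) • J2 n) := by
  ext r s
  rw [phaseMatrix_conj_apply]
  simp only [J1_eq, J2_eq, Matrix.smul_apply, Matrix.add_apply, complexify_apply, realIJ2, realJ1,
    Matrix.sub_apply, Matrix.transpose_apply, raiseR, Matrix.of_apply, smul_eq_mul]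
  have hI := Complex.I_mul_I
  have hs := phase_pow_mul_star_pow φ s
  have hr := phase_pow_mul_star_pow φ r
  by_cases h1 : (r : ℕ) = s + 1
  · have h2 : ¬ (s : ℕ) = r + 1 := by omega
    rw [if_pos h1, if_neg h2, h1, pow_succ]
    have e : phase φ ^ (s : ℕ) * phase φ * ((1 / 2 * (ladder n s - 0) : ℝ) : ℂ) *
        star (phase φ) ^ (s : ℕ) = phase φ * ((1 / 2 * (ladder n s - 0) : ℝ) : ℂ) := by
      linear_combination phase φ * ((1 / 2 * (ladder n s - 0) : ℝ) : ℂ) * hs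
    rw [e, phase_eq]
    push_cast
    linear_combination ((ladder n s : ℂ) / 2 * Complex.cos φ) * hI
  · by_cases h2 : (s : ℕ) = r + 1
    · rw [if_neg h1, if_pos h2, h2, pow_succ]
      have e : phase φ ^ (r : ℕ) * ((1 / 2 * (0 - ladder n r) : ℝ) : ℂ) *
          (star (phase φ) ^ (r : ℕ) * star (phase φ)) =
          star (phase φ) * ((1 / 2 * (0 - ladder n r) : ℝ) : ℂ) := by
        linear_combination star (phase φ) * ((1 / 2 * (0 - ladder n r) : ℝ) : ℂ) * hr
      rw [e, star_phase]
      push_cast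
      linear_combination -((ladder n r : ℂ) / 2 * Complex.cos φ) * hI
    · rw [if_neg h1, if_neg h2]; simp

open scoped Matrix.Norms.Operator in
theorem complexify_exp (n : ℕ) (A : Matrix (Fin (n + 1)) (Fin (n + 1)) ℝ) :
    complexify n (NormedSpace.exp A) = NormedSpace.exp (complexify n A) := by
  refine NormedSpace.map_exp (complexify n) ?_ A
  exact continuous_pi fun r => continuous_pi fun s =>
    Complex.continuous_ofReal.comp ((continuous_apply s).comp (continuous_apply r))

theorem rot_polar (n : ℕ) (β φ : ℝ) : rot n (polar β φ) =
    phaseMatrix n φ * complexify n (rotR n β) * (phaseMatrix n φ)ᴴ := by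
  have hinv : (phaseMatrix n φ)⁻¹ = (phaseMatrix n φ)ᴴ :=
    Matrix.inv_eq_right_inv (phaseMatrix_mul_conjTranspose n φ)
  have hu : IsUnit (phaseMatrix n φ) :=
    IsUnit.of_mul_eq_one _ (phaseMatrix_mul_conjTranspose n φ)
  rw [rotR, complexify_exp, ← hinv, ← Matrix.exp_conj _ _ hu, hinv, complexify_smul,
    Matrix.mul_smul, Matrix.smul_mul, phaseMatrix_conj_realIJ2, rot, smul_comm]
  simp only [polar, PiLp.toLp_apply, Matrix.cons_val_zero, Matrix.cons_val_one]
  congr 2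
  push_cast
  module

/-- Diagonal matrices commute with the phases, so the azimuth survives only as outer phase factors
around a real matrix. -/
theorem rot_conj_diagonal (n : ℕ) (β φ : ℝ) (d : Fin (n + 1) → ℝ) (r s : Fin (n + 1)) :
    (rot n (polar β φ) * complexify n (Matrix.diagonal d) * (rot n (polar β φ))ᴴ) r s =
      phase φ ^ (r : ℕ) * ((rotR n β * Matrix.diagonal d * (rotR n β)ᵀ) r s : ℝ) *
        star (phase φ) ^ (s : ℕ) := by
  have hc : (phaseMatrix n φ)ᴴ * complexify n (Matrix.diagonal d) * phaseMatrix n φ =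
      complexify n (Matrix.diagonal d) := by
    have e : complexify n (Matrix.diagonal d) = Matrix.diagonal fun r => (d r : ℂ) := by
      ext r s
      simp only [complexify_apply, Matrix.diagonal_apply]
      split_ifs <;> simp
    rw [e, phaseMatrix, Matrix.diagonal_conjTranspose, Matrix.diagonal_mul_diagonal,
      Matrix.diagonal_mul_diagonal]
    congr 1
    ext r
    rw [Pi.star_apply, star_pow, mul_right_comm, mul_comm (star (phase φ) ^ (r : ℕ)),
      phase_pow_mul_star_pow, one_mul]
  have h : rot n (polar β φ) * complexify n (Matrix.diagonal d) * (rot n (polar β φ))ᴴ =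
      phaseMatrix n φ * complexify n (rotR n β * Matrix.diagonal d * (rotR n β)ᵀ) *
        (phaseMatrix n φ)ᴴ := by
    rw [rot_polar, Matrix.conjTranspose_mul, Matrix.conjTranspose_mul,
      Matrix.conjTranspose_conjTranspose, map_mul, map_mul, complexify_transpose]
    conv_rhs => rw [← hc]
    simp only [Matrix.mul_assoc]
  rw [h, phaseMatrix_conj_apply, complexify_apply]

theorem dicke_eq (n : ℕ) (k : Fin (n + 1)) :
    dicke n k = complexify n (Matrix.diagonal (Pi.single k 1)) := by
  ext r s
  simp only [complexify_apply, dicke, Matrix.single_apply, Matrix.diagonal_apply, Pi.single_apply]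
  split_ifs <;> first | (simp; done) | (exfalso; grind)

theorem model_polar_apply (n : ℕ) (k : Fin (n + 1)) (β φ : ℝ) (r s : Fin (n + 1)) :
    model n (dicke n k) (polar β φ) r s =
      phase φ ^ (r : ℕ) * ((rotR n β r k * rotR n β s k : ℝ) : ℂ) * star (phase φ) ^ (s : ℕ) := by
  rw [model, dicke_eq, rot_conj_diagonal]
  congr 3
  rw [Matrix.mul_apply, Finset.sum_eq_single k]
  · simp [Matrix.mul_diagonal]
  · intro b _ hb; simp [Matrix.mul_diagonal, hb]
  · simp

theorem rot_conj_J3_apply (n : ℕ) (β φ : ℝ) (r s : Fin (n + 1)) :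
    (rot n (polar β φ) * J3 n * (rot n (polar β φ))ᴴ) r s =
      phase φ ^ (r : ℕ) * ((Real.cos β * realJ3 n r s - Real.sin β * realJ1 n r s : ℝ) : ℂ) *
        star (phase φ) ^ (s : ℕ) := by
  rw [J3_eq, realJ3, rot_conj_diagonal, ← realJ3, rotR_mul_realJ3, Matrix.mul_assoc,
    rotR_mul_transpose, Matrix.mul_one]
  simp only [Matrix.sub_apply, Matrix.smul_apply, smul_eq_mul]

/-! ### The fidelity -/

theorem fidelity_comm (θ θ' : EuclideanSpace ℝ (Fin 2)) : fidelity θ θ' = fidelity θ' θ := by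
  have h : (rot 1 θ)ᴴ * rot 1 θ' = ((rot 1 θ')ᴴ * rot 1 θ)ᴴ := by
    rw [Matrix.conjTranspose_mul, Matrix.conjTranspose_conjTranspose]
  rw [fidelity, fidelity, h, Matrix.conjTranspose_apply, norm_star]

/-- Orthogonality and the rotated `J₃` determine the products of entries, which is all the fidelity
needs. -/
theorem rotR_one (β : ℝ) : rotR 1 β 1 1 ^ 2 = (1 + Real.cos β) / 2 ∧
    rotR 1 β 0 1 ^ 2 = (1 - Real.cos β) / 2 ∧ rotR 1 β 0 1 * rotR 1 β 1 1 = -Real.sin β / 2 := by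
  have h : rotR 1 β * realJ3 1 * (rotR 1 β)ᵀ = Real.cos β • realJ3 1 - Real.sin β • realJ1 1 := by
    rw [rotR_mul_realJ3, Matrix.mul_assoc, rotR_mul_transpose, Matrix.mul_one]
  have h' := rotR_mul_transpose 1 β
  rw [← Matrix.ext_iff] at h h'
  have h11 := h 1 1
  have h00 := h 0 0
  have h01 := h 0 1
  have g11 := h' 1 1
  have g00 := h' 0 0
  have g01 := h' 0 1
  simp [Matrix.mul_apply, Fin.sum_univ_two, realJ3, realJ1, raiseR, wt, ladder_one_zero,
    Matrix.diagonal_apply] at h11 h00 h01 g11 g00 g01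
  refine ⟨?_, ?_, ?_⟩ <;> linarith

/-- The fidelity is `(1 + cos γ)/2`, where `γ` is the angle between the two Bloch vectors. -/
theorem fidelity_polar (β φ β' φ' : ℝ) : fidelity (polar β φ) (polar β' φ') =
    (1 + Real.cos β * Real.cos β' + Real.sin β * Real.sin β' * Real.cos (φ - φ')) / 2 := by
  obtain ⟨h1, h2, h3⟩ := rotR_one β
  obtain ⟨h1', h2', h3'⟩ := rotR_one β'
  have e1 := phase_mul_star φ
  have e2 := phase_mul_star φ'
  have key : ((rot 1 (polar β φ))ᴴ * rot 1 (polar β' φ')) 1 1 =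
      phase φ * star (phase φ') * ((rotR 1 β 0 1 * rotR 1 β' 0 1 : ℝ) : ℂ) +
        ((rotR 1 β 1 1 * rotR 1 β' 1 1 : ℝ) : ℂ) := by
    rw [Matrix.mul_apply, Fin.sum_univ_two, Matrix.conjTranspose_apply, Matrix.conjTranspose_apply,
      rot_polar, rot_polar]
    simp only [phaseMatrix_conj_apply, complexify_apply]
    simp only [Fin.val_zero, Fin.val_one, pow_zero, pow_one, one_mul, star_mul', star_star]
    have hr : ∀ x : ℝ, star (x : ℂ) = x := fun x => Complex.conj_ofReal x
    rw [hr, hr]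
    push_cast
    linear_combination (rotR 1 β 1 1 * rotR 1 β' 1 1 : ℂ) * (phase φ * star (phase φ)) * e2 +
      (rotR 1 β 1 1 * rotR 1 β' 1 1 : ℂ) * e1
  have hp : phase φ * star (phase φ') =
      (Real.cos (φ - φ') : ℂ) + (Real.sin (φ - φ') : ℂ) * Complex.I := by
    rw [← phase_eq, phase, phase, phase, Complex.star_def, ← Complex.exp_conj, ← Complex.exp_add]
    congr 1
    simp; ring
  rw [fidelity, key, hp, ← Complex.normSq_eq_norm_sq, Complex.normSq_apply]
  have hcs := Real.sin_sq_add_cos_sq (φ - φ')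
  simp only [Complex.add_re, Complex.add_im, Complex.mul_re, Complex.mul_im, Complex.ofReal_re,
    Complex.ofReal_im, Complex.I_re, Complex.I_im]
  linear_combination (rotR 1 β 0 1 * rotR 1 β' 0 1) ^ 2 * hcs + rotR 1 β' 1 1 ^ 2 * h1 +
    (1 + Real.cos β) / 2 * h1' + rotR 1 β' 0 1 ^ 2 * h2 + (1 - Real.cos β) / 2 * h2' +
    2 * Real.cos (φ - φ') * (rotR 1 β' 0 1 * rotR 1 β' 1 1) * h3 -
    Real.cos (φ - φ') * Real.sin β * h3'

/-! ### The azimuthal average -/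

theorem sum_phase_pow_mul_star_pow {N a b : ℕ} (ha : a < N) (hb : b < N) :
    ∑ l : Fin N, phase (2 * Real.pi * l / N) ^ a * star (phase (2 * Real.pi * l / N)) ^ b =
      if a = b then (N : ℂ) else 0 := by
  split_ifs with h
  · subst h
    simp only [phase_pow_mul_star_pow]
    simp
  · have hN : N ≠ 0 := by omega
    let ω : ℂ := Complex.exp (2 * Real.pi * Complex.I / N)
    have hω : IsPrimitiveRoot ω N := Complex.isPrimitiveRoot_exp N hN
    have hω0 : ω ≠ 0 := Complex.exp_ne_zero _
    have hph : ∀ l : ℕ, phase (2 * Real.pi * l / N) = ω ^ l := by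
      intro l
      rw [phase, ← Complex.exp_nat_mul]
      congr 1
      push_cast; ring
    have hst : ∀ φ, star (phase φ) = (phase φ)⁻¹ := fun φ =>
      eq_inv_of_mul_eq_one_right (phase_mul_star φ)
    let q : ℂ := ω ^ a * (ω ^ b)⁻¹
    have hq : q ≠ 1 := by
      intro hq
      apply h
      apply hω.pow_inj ha hb
      rwa [mul_inv_eq_one₀ (pow_ne_zero _ hω0)] at hq
    have hqN : q ^ N = 1 := by
      simp only [q]
      rw [mul_pow, inv_pow, ← pow_mul, ← pow_mul, mul_comm a, mul_comm b, pow_mul, pow_mul,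
        hω.pow_eq_one]
      simp
    have hterm : ∀ l : Fin N, phase (2 * Real.pi * l / N) ^ a *
        star (phase (2 * Real.pi * l / N)) ^ b = q ^ (l : ℕ) := by
      intro l
      rw [hst, hph]
      simp only [q]
      rw [mul_pow, inv_pow, inv_pow, ← pow_mul, ← pow_mul, ← pow_mul, ← pow_mul, mul_comm a,
        mul_comm b]
    rw [Finset.sum_congr rfl fun l _ => hterm l, Fin.sum_univ_eq_sum_range (fun l => q ^ l),
      geom_sum_eq hq, hqN]
    simp

/-- The cosine shifts the frequency `r - s` by `±1`. The exponents are at most `n + 1`, below the `n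
+ 3` nodes, so no aliasing occurs. -/
theorem sum_azimuth (n : ℕ) (r s : Fin (n + 1)) (u v φ' : ℝ) :
    ∑ l : Fin (n + 3), (((u + v * Real.cos (φ' - 2 * Real.pi * l / (n + 3 : ℕ)) : ℝ)) : ℂ) *
      (phase (2 * Real.pi * l / (n + 3 : ℕ)) ^ (r : ℕ) *
        star (phase (2 * Real.pi * l / (n + 3 : ℕ))) ^ (s : ℕ)) =
      ((n + 3 : ℕ) : ℂ) * ((if (r : ℕ) = s then (u : ℂ) else 0) +
        (v : ℂ) / 2 * ((if (r : ℕ) = s + 1 then phase φ' else 0) +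
          if (s : ℕ) = r + 1 then star (phase φ') else 0)) := by
  have hcos : ∀ φ : ℝ, (Real.cos (φ' - φ) : ℂ) =
      (phase φ' * star (phase φ) + star (phase φ') * phase φ) / 2 := by
    intro φ
    rw [Real.cos_sub, star_phase, star_phase, phase_eq, phase_eq]
    push_cast
    linear_combination (Complex.sin φ' * Complex.sin φ) * Complex.I_mul_I
  have hterm : ∀ φ : ℝ, ((u + v * Real.cos (φ' - φ) : ℝ) : ℂ) *
      (phase φ ^ (r : ℕ) * star (phase φ) ^ (s : ℕ)) =
      u * (phase φ ^ (r : ℕ) * star (phase φ) ^ (s : ℕ)) + (v : ℂ) / 2 *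
        (phase φ' * (phase φ ^ (r : ℕ) * star (phase φ) ^ ((s : ℕ) + 1)) +
          star (phase φ') * (phase φ ^ ((r : ℕ) + 1) * star (phase φ) ^ (s : ℕ))) := by
    intro φ
    push_cast [hcos]
    ring
  simp_rw [hterm]
  rw [Finset.sum_add_distrib, ← Finset.mul_sum, ← Finset.mul_sum, Finset.sum_add_distrib,
    ← Finset.mul_sum, ← Finset.mul_sum, sum_phase_pow_mul_star_pow (by omega) (by omega),
    sum_phase_pow_mul_star_pow (by omega) (by omega),
    sum_phase_pow_mul_star_pow (by omega) (by omega)]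
  simp only [eq_comm (a := (r : ℕ) + 1)]
  split_ifs <;> ring

/-- A finite family of parameters that averages over the sphere `SU(2)/U(1)`. -/
theorem exists_design (n : ℕ) (hn : 1 ≤ n) (k : Fin (n + 1)) :
    ∃ (ι : Type) (_ : Fintype ι) (w : ι → ℝ) (θ : ι → Param), (∀ i, 0 ≤ w i) ∧ ∑ i, w i = 1 ∧
      ∀ θ' : Param, ∑ i, ((w i * fidelity θ' (θ i) : ℝ) : ℂ) • model n (dicke n k) (θ i) =
        (1 / 2 : ℂ) • ((((n : ℝ) + 1)⁻¹ : ℝ) • (1 : Matrix (Fin (n + 1)) (Fin (n + 1)) ℂ) +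
          (vectorCoeff n k : ℝ) • (rot n θ' * J3 n * (rot n θ')ᴴ)) := by
  -- All polar moments left after the azimuthal sum; the missing factor `sin β` is the quadrature
  -- weight.
  let F : ℝ → (Fin (n + 1) ⊕ Fin (n + 1)) ⊕ (Fin (n + 1) × Fin (n + 1)) → ℝ := fun β =>
    Sum.elim (Sum.elim (fun r => rotR n β r k ^ 2) fun r => Real.cos β * rotR n β r k ^ 2)
      fun x => Real.sin β * (rotR n β x.1 k * rotR n β x.2 k)
  have hF : Continuous F := by
    have hc := continuous_rotR_apply n
    refine continuous_pi ?_
    rintro ((r | r) | ⟨r, s⟩) <;> simp only [F, Sum.elim_inl, Sum.elim_inr] <;> fun_prop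
  obtain ⟨κ, _, w, x, hw, hw1, hx, hquad⟩ := exists_finite_quadrature hF
  obtain ⟨hK, hI⟩ := vector_moments n hn k
  have m0 : ∀ r, ∑ a, w a * rotR n (x a) r k ^ 2 = ((n : ℝ) + 1)⁻¹ := by
    intro r
    refine (hquad (Sum.inl (Sum.inl r))).trans ?_
    simp only [F, Sum.elim_inl]
    rw [integral_sin_mul_sq]; field_simp
  have m3 : ∀ r, ∑ a, w a * (Real.cos (x a) * rotR n (x a) r k ^ 2) = vectorCoeff n k * wt n r := by
    intro r
    refine (hquad (Sum.inl (Sum.inr r))).trans ?_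
    simp only [F, Sum.elim_inl, Sum.elim_inr, ← mul_assoc]
    rw [hI]; ring
  have m1 : ∀ r s : Fin (n + 1), (s : ℕ) = r + 1 →
      ∑ a, w a * (Real.sin (x a) * (rotR n (x a) r k * rotR n (x a) s k)) =
        -vectorCoeff n k * ladder n r := by
    intro r s h
    refine (hquad (Sum.inr (r, s))).trans ?_
    simp only [F, Sum.elim_inr, ← mul_assoc (Real.sin _) (Real.sin _), ← pow_two]
    rw [hK r s h]; ring
  have hxm : ∀ a φ, polar (x a) φ ∈ Metric.closedBall (0 : EuclideanSpace ℝ (Fin 2)) Real.pi := by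
    intro a φ
    rw [mem_closedBall_zero_iff, norm_polar (hx a).1]; exact (hx a).2
  have hN : ((n + 3 : ℕ) : ℝ) ≠ 0 := by positivity
  have hN' : ((n + 3 : ℕ) : ℂ) ≠ 0 := by exact_mod_cast (by omega : n + 3 ≠ 0)
  refine ⟨κ × Fin (n + 3), inferInstance, fun i => w i.1 / (n + 3 : ℕ),
    fun i => ⟨polar (x i.1) (2 * Real.pi * i.2 / (n + 3 : ℕ)), hxm _ _⟩,
    fun i => div_nonneg (hw _) (by positivity), ?_, ?_⟩
  · rw [Fintype.sum_prod_type]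
    simp only [Finset.sum_const, Finset.card_univ, Fintype.card_fin, nsmul_eq_mul]
    rw [← hw1]
    exact Finset.sum_congr rfl fun a _ => by field_simp
  · rintro ⟨θ', hθ'⟩
    obtain ⟨φ', hφ'⟩ := exists_polar θ'
    generalize ‖θ'‖ = β' at hφ'
    subst hφ'
    ext r s
    rw [Matrix.sum_apply, Fintype.sum_prod_type]
    have hinner : ∀ a, ∑ l : Fin (n + 3), (((w a / (n + 3 : ℕ) *
        fidelity (polar β' φ') (polar (x a) (2 * Real.pi * l / (n + 3 : ℕ))) : ℝ) : ℂ) •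
        model n (dicke n k) (polar (x a) (2 * Real.pi * l / (n + 3 : ℕ)))) r s =
        (1 / 2 : ℂ) * (
          ((w a * (rotR n (x a) r k * rotR n (x a) s k) : ℝ) + (Real.cos β' : ℂ) *
            (w a * (Real.cos (x a) * (rotR n (x a) r k * rotR n (x a) s k)) : ℝ)) *
            (if (r : ℕ) = s then 1 else 0) +
          (Real.sin β' : ℂ) / 2 *
            (w a * (Real.sin (x a) * (rotR n (x a) r k * rotR n (x a) s k)) : ℝ) *
            ((if (r : ℕ) = s + 1 then phase φ' else 0) +
              if (s : ℕ) = r + 1 then star (phase φ') else 0)) := by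
      intro a
      have h := sum_azimuth n r s (1 + Real.cos β' * Real.cos (x a))
        (Real.sin β' * Real.sin (x a)) φ'
      have ht : ∀ l : Fin (n + 3), (((w a / (n + 3 : ℕ) *
          fidelity (polar β' φ') (polar (x a) (2 * Real.pi * l / (n + 3 : ℕ))) : ℝ) : ℂ) •
          model n (dicke n k) (polar (x a) (2 * Real.pi * l / (n + 3 : ℕ)))) r s =
          (w a * (rotR n (x a) r k * rotR n (x a) s k) : ℝ) / (2 * ((n + 3 : ℕ) : ℂ)) *
          ((((1 + Real.cos β' * Real.cos (x a)) + (Real.sin β' * Real.sin (x a)) *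
            Real.cos (φ' - 2 * Real.pi * l / (n + 3 : ℕ)) : ℝ) : ℂ) *
          (phase (2 * Real.pi * l / (n + 3 : ℕ)) ^ (r : ℕ) *
            star (phase (2 * Real.pi * l / (n + 3 : ℕ))) ^ (s : ℕ))) := by
        intro l
        rw [Matrix.smul_apply, model_polar_apply, fidelity_polar, smul_eq_mul]
        generalize Real.cos (φ' - _) = C
        push_cast
        field_simp
      rw [Finset.sum_congr rfl fun l _ => ht l, ← Finset.mul_sum, h]
      push_cast
      split_ifs <;> field_simp <;> ring
    refine (Finset.sum_congr rfl fun a _ => hinner a).trans ?_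
    rw [← Finset.mul_sum, Finset.sum_add_distrib, ← Finset.sum_mul, ← Finset.sum_mul,
      Finset.sum_add_distrib, ← Finset.mul_sum, ← Finset.mul_sum, ← Complex.ofReal_sum,
      ← Complex.ofReal_sum, ← Complex.ofReal_sum]
    simp only [Matrix.smul_apply, Matrix.add_apply, rot_conj_J3_apply, smul_eq_mul,
      Complex.real_smul]
    congr 1
    have hps := phase_pow_mul_star_pow φ'
    clear hinner
    generalize star (phase φ') = y at hps ⊢
    generalize phase φ' = z at hps ⊢
    -- Only the diagonal and its two neighbours can be nonzero: the diagonal gives the scalar and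
    -- `J₃` parts, the neighbours the `J₁` part.
    by_cases h0 : r = s
    · subst h0
      simp only [← pow_two, m0, m3]
      simp [realJ3, realJ1, raiseR]
      linear_combination -(vectorCoeff n k * Complex.cos β' * wt n r : ℂ) * hps r
    · have h0' : ¬(r : ℕ) = s := fun h => h0 (Fin.ext h)
      by_cases h1 : (r : ℕ) = s + 1
      · have e : ∀ a, rotR n (x a) r k * rotR n (x a) s k = rotR n (x a) s k * rotR n (x a) r k :=
          fun a => mul_comm _ _
        simp only [e, m1 s r h1]
        simp [realJ3, realJ1, raiseR, h0, h1, pow_succ,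
          show ¬(s : ℕ) = s + 1 + 1 by omega]
        linear_combination -(vectorCoeff n k * Complex.sin β' * ladder n s * z / 2 : ℂ) * hps s
      · by_cases h2 : (s : ℕ) = r + 1
        · simp only [m1 r s h2]
          simp [realJ3, realJ1, raiseR, h0, h2, pow_succ,
            show ¬(r : ℕ) = r + 1 + 1 by omega]
          linear_combination
            -(vectorCoeff n k * Complex.sin β' * ladder n r * y / 2 : ℂ) * hps r
        · simp [realJ3, realJ1, raiseR, h0, h0', h1, h2]

/-! ### Laws of the outcomes of a measurement -/

section OutcomeLaw

variable {X : Type*} [MeasurableSpace X] {ι : Type*} [Fintype ι] [DecidableEq ι]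

theorem outcomeLaw_apply (M : POVM X ι) {ρ : Matrix ι ι ℂ} (hρ : ρ.PosSemidef) {B : Set X}
    (hB : MeasurableSet B) :
    outcomeLaw M ρ hρ B = ENNReal.ofReal (Matrix.trace (ρ * M.toVectorMeasure B)).re :=
  Measure.ofMeasurable_apply B hB

instance isFiniteMeasure_outcomeLaw (M : POVM X ι) {ρ : Matrix ι ι ℂ} (hρ : ρ.PosSemidef) :
    IsFiniteMeasure (outcomeLaw M ρ hρ) :=
  ⟨by rw [outcomeLaw_apply M hρ MeasurableSet.univ]; exact ENNReal.ofReal_lt_top⟩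

theorem outcomeLaw_real_apply (M : POVM X ι) {ρ : Matrix ι ι ℂ} (hρ : ρ.PosSemidef) {B : Set X}
    (hB : MeasurableSet B) :
    (outcomeLaw M ρ hρ).real B = (Matrix.trace (ρ * M.toVectorMeasure B)).re := by
  rw [measureReal_def, outcomeLaw_apply M hρ hB,
    ENNReal.toReal_ofReal (trace_mul_re_nonneg hρ (M.posSemidef B))]

theorem integral_comp_simpleFunc (μ : Measure X) [IsFiniteMeasure μ] {Y : Type*}
    (s : SimpleFunc X Y) (g : Y → ℝ) :
    ∫ x, g (s x) ∂μ = ∑ y ∈ s.range, μ.real (s ⁻¹' {y}) * g y := by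
  classical
  have h : ∀ x, g (s x) = ∑ y ∈ s.range, (s ⁻¹' {y}).indicator (fun _ => g y) x := by
    intro x
    rw [Finset.sum_eq_single (s x)]
    · simp
    · intro y _ hy
      exact Set.indicator_of_notMem (fun h => hy h.symm) _
    · intro h; exact absurd (s.mem_range_self x) h
  simp_rw [h]
  rw [integral_finsetSum]
  · refine Finset.sum_congr rfl fun y _ => ?_
    rw [integral_indicator_const _ (s.measurableSet_fiber y), smul_eq_mul]
  · intro y _
    exact (integrable_const _).indicator (s.measurableSet_fiber y)

end OutcomeLaw

/-- A Bayes bound: if the weighted operator at every outcome is at most `c`, the average score is at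
most `c Tr M(X)`. Rounding outcomes to finitely many points reduces the integrals to sums of traces,
and dominated convergence removes the rounding. -/
theorem sum_integral_outcomeLaw_le {X : Type*} [MetricSpace X] [CompactSpace X] [Nonempty X]
    [MeasurableSpace X] [BorelSpace X] {ι κ : Type*} [Fintype ι] [DecidableEq ι] [Fintype κ]
    (M : POVM X ι) (w : κ → ℝ) {ρ : κ → Matrix ι ι ℂ} (hρ : ∀ i, (ρ i).PosSemidef)
    {g : κ → X → ℝ} (hg : ∀ i, Continuous (g i)) {c : ℝ}
    (h : ∀ x, ((c : ℂ) • (1 : Matrix ι ι ℂ) -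
      ∑ i, ((w i * g i x : ℝ) : ℂ) • ρ i).PosSemidef) :
    ∑ i, w i * ∫ x, g i x ∂(outcomeLaw M (ρ i) (hρ i)) ≤ c * Fintype.card ι := by
  let s : ℕ → SimpleFunc X X := SimpleFunc.nearestPt (TopologicalSpace.denseSeq X)
  have hs : ∀ x, Tendsto (fun N => s N x) atTop (𝓝 x) := fun x =>
    SimpleFunc.tendsto_nearestPt (TopologicalSpace.denseRange_denseSeq X x)
  have hlim : Tendsto (fun N => ∑ i, w i * ∫ x, g i (s N x) ∂(outcomeLaw M (ρ i) (hρ i))) atTop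
      (𝓝 (∑ i, w i * ∫ x, g i x ∂(outcomeLaw M (ρ i) (hρ i)))) := by
    refine tendsto_finsetSum _ fun i _ => Tendsto.const_mul _ ?_
    obtain ⟨C, hC⟩ := isCompact_univ.exists_bound_of_continuousOn (hg i).continuousOn
    refine tendsto_integral_of_dominated_convergence (fun _ => C) (fun N => ?_)
      (integrable_const C) (fun N => ?_) ?_
    · exact ((hg i).measurable.comp (s N).measurable).aestronglyMeasurable
    · exact Eventually.of_forall fun x => hC _ (Set.mem_univ _)
    · exact Eventually.of_forall fun x => ((hg i).tendsto x).comp (hs x)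
  refine le_of_tendsto' hlim fun N => ?_
  have hone : ∑ y ∈ (s N).range, (Matrix.trace (M.toVectorMeasure (s N ⁻¹' {y}))).re =
      Fintype.card ι := by
    have h1 := integral_comp_simpleFunc (outcomeLaw M 1 Matrix.PosSemidef.one) (s N) fun _ => 1
    rw [integral_const, outcomeLaw_real_apply _ _ MeasurableSet.univ, M.total] at h1
    simp only [outcomeLaw_real_apply M Matrix.PosSemidef.one ((s N).measurableSet_fiber _),
      Matrix.one_mul, mul_one, Matrix.trace_one, smul_eq_mul, Complex.natCast_re] at h1
    exact h1.symm
  simp_rw [integral_comp_simpleFunc, Finset.mul_sum]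
  rw [Finset.sum_comm, ← hone, Finset.mul_sum]
  refine Finset.sum_le_sum fun y _ => ?_
  have hy := trace_mul_re_nonneg (h y) (M.posSemidef (s N ⁻¹' {y}))
  rw [Matrix.sub_mul, Matrix.smul_mul, Matrix.one_mul, Matrix.sum_mul, Matrix.trace_sub,
    Matrix.trace_sum, Matrix.trace_smul, Complex.sub_re, smul_eq_mul, Complex.re_ofReal_mul,
    Complex.re_sum] at hy
  refine le_trans (le_of_eq ?_) (sub_nonneg.mp hy)
  refine Finset.sum_congr rfl fun i _ => ?_
  rw [outcomeLaw_real_apply _ _ ((s N).measurableSet_fiber y), Matrix.smul_mul, Matrix.trace_smul,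
    smul_eq_mul, Complex.re_ofReal_mul]
  ring

/-! ### Measurements with finitely many outcomes -/

open Classical in
theorem sum_vectorMeasure_dirac_apply {X M κ : Type*} [MeasurableSpace X] [AddCommMonoid M]
    [TopologicalSpace M] [ContinuousAdd M] [Fintype κ] (x : κ → X) (A : κ → M) {B : Set X}
    (hB : MeasurableSet B) :
    (∑ i, VectorMeasure.dirac (x i) (A i)) B = ∑ i, if x i ∈ B then A i else 0 := by
  rw [FunLike.coe_sum, Finset.sum_apply]
  refine Finset.sum_congr rfl fun i _ => ?_
  split_ifs with h
  · exact VectorMeasure.dirac_apply_of_mem hB h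
  · exact VectorMeasure.dirac_apply_of_notMem h

/-- The measurement with the effects `A i` and the outcomes `x i`. -/
def discretePOVM {X : Type*} [MeasurableSpace X] {ι κ : Type*} [Fintype ι] [DecidableEq ι]
    [Fintype κ] (x : κ → X) (A : κ → Matrix ι ι ℂ) (hA : ∀ i, (A i).PosSemidef)
    (h1 : ∑ i, A i = 1) : POVM X ι where
  toVectorMeasure := ∑ i, VectorMeasure.dirac (x i) (A i)
  posSemidef B := by
    classical
    by_cases hB : MeasurableSet B
    · rw [sum_vectorMeasure_dirac_apply x A hB]
      refine Matrix.posSemidef_sum _ fun i _ => ?_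
      split_ifs
      · exact hA i
      · exact Matrix.PosSemidef.zero
    · rw [VectorMeasure.not_measurable _ hB]
      exact Matrix.PosSemidef.zero
  total := by
    rw [sum_vectorMeasure_dirac_apply x A MeasurableSet.univ]
    simpa using h1

theorem integral_outcomeLaw_discretePOVM {X : Type*} [MeasurableSpace X]
    [MeasurableSingletonClass X] {ι κ : Type*} [Fintype ι]
    [DecidableEq ι] [Fintype κ] (x : κ → X) {A : κ → Matrix ι ι ℂ} (hA : ∀ i, (A i).PosSemidef)
    (h1 : ∑ i, A i = 1) {ρ : Matrix ι ι ℂ} (hρ : ρ.PosSemidef) (g : X → ℝ) :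
    ∫ y, g y ∂(outcomeLaw (discretePOVM x A hA h1) ρ hρ) =
      ∑ i, (Matrix.trace (ρ * A i)).re * g (x i) := by
  classical
  have hlaw : outcomeLaw (discretePOVM x A hA h1) ρ hρ =
      ∑ i, ENNReal.ofReal (Matrix.trace (ρ * A i)).re • Measure.dirac (x i) := by
    ext B hB
    rw [outcomeLaw_apply _ _ hB, Measure.finsetSum_apply]
    change ENNReal.ofReal (Matrix.trace (ρ * (∑ i, VectorMeasure.dirac (x i) (A i)) B)).re = _
    rw [sum_vectorMeasure_dirac_apply x A hB, Matrix.mul_sum, Matrix.trace_sum, Complex.re_sum,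
      ENNReal.ofReal_sum_of_nonneg]
    · refine Finset.sum_congr rfl fun i _ => ?_
      rw [Measure.smul_apply, Measure.dirac_apply' _ hB]
      by_cases h : x i ∈ B <;> simp [h]
    · intro i _
      split_ifs
      · exact trace_mul_re_nonneg hρ (hA i)
      · simp
  rw [hlaw, integral_finsetSum_measure]
  · refine Finset.sum_congr rfl fun i _ => ?_
    rw [integral_smul_measure, integral_dirac, smul_eq_mul,
      ENNReal.toReal_ofReal (trace_mul_re_nonneg hρ (hA i))]
  · intro i _
    exact (integrable_dirac (by simp)).smul_measure ENNReal.ofReal_ne_top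

/-! ### Global estimation -/

instance compactSpace_param : CompactSpace Param :=
  isCompact_iff_compactSpace.mp (isCompact_closedBall _ _)

instance nonempty_param : Nonempty Param :=
  ⟨⟨0, Metric.mem_closedBall_self Real.pi_pos.le⟩⟩

open scoped Matrix.Norms.Operator in
theorem continuous_rot (n : ℕ) : Continuous (rot n) := by
  have h : Continuous fun θ : EuclideanSpace ℝ (Fin 2) =>
      Complex.I • (((θ 0 : ℝ) : ℂ) • J1 n + ((θ 1 : ℝ) : ℂ) • J2 n) := by fun_prop
  exact NormedSpace.exp_continuous.comp h

theorem continuous_fidelity (θ : EuclideanSpace ℝ (Fin 2)) : Continuous (fidelity θ) := by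
  have h := continuous_rot 1
  have h2 : Continuous fun θ' => ((rot 1 θ)ᴴ * rot 1 θ') 1 1 :=
    (continuous_const.matrix_mul h).matrix_elem 1 1
  exact h2.norm.pow 2

theorem fidelity_nonneg (θ θ' : EuclideanSpace ℝ (Fin 2)) : 0 ≤ fidelity θ θ' := sq_nonneg _

theorem rot_mul_conjTranspose (n : ℕ) (θ : EuclideanSpace ℝ (Fin 2)) : rot n θ * (rot n θ)ᴴ = 1 := by
  obtain ⟨φ, hφ⟩ := exists_polar θ
  rw [hφ]
  ext r s
  have h := rot_conj_diagonal n ‖θ‖ φ (fun _ => 1) r s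
  rw [Matrix.diagonal_one, map_one, Matrix.mul_one, Matrix.mul_one, rotR_mul_transpose] at h
  rw [h]
  by_cases hrs : r = s
  · subst hrs
    rw [Matrix.one_apply_eq, Complex.ofReal_one, mul_one, phase_pow_mul_star_pow,
      Matrix.one_apply_eq]
  · rw [Matrix.one_apply_ne hrs, Matrix.one_apply_ne hrs]; simp

theorem rot_conjTranspose_mul (n : ℕ) (θ : EuclideanSpace ℝ (Fin 2)) : (rot n θ)ᴴ * rot n θ = 1 :=
  mul_eq_one_comm.mp (rot_mul_conjTranspose n θ)

theorem globalFidelity_le_integral (n : ℕ) {ρ : Matrix (Fin (n + 1)) (Fin (n + 1)) ℂ}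
    (hρ : ρ.PosSemidef) (M : POVM Param (Fin (n + 1))) (θ : Param) :
    globalFidelity n ρ hρ M ≤
      ∫ θ' : Param, fidelity θ θ' ∂(outcomeLaw M (model n ρ θ) (model_posSemidef n hρ θ)) := by
  refine ciInf_le ⟨0, ?_⟩ θ
  rintro _ ⟨θ, rfl⟩
  exact integral_nonneg fun θ' => fidelity_nonneg _ _

/-- The difference is a multiple of the rotated `j - J₃`; the sign of `a` enters here, making that
multiple nonnegative. -/
theorem posSemidef_bound (n : ℕ) (k : Fin (n + 1)) (hn : 1 ≤ n) (hk : 0 ≤ wt n k)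
    (θ : EuclideanSpace ℝ (Fin 2)) :
    (((((n : ℝ) / 2 + wt n k + 1) / ((n : ℝ) + 2) / (n + 1) : ℝ) : ℂ) •
      (1 : Matrix (Fin (n + 1)) (Fin (n + 1)) ℂ) -
      (1 / 2 : ℂ) • ((((n : ℝ) + 1)⁻¹ : ℝ) • (1 : Matrix (Fin (n + 1)) (Fin (n + 1)) ℂ) +
          (vectorCoeff n k : ℝ) • (rot n θ * J3 n * (rot n θ)ᴴ))).PosSemidef := by
  have hn' : (1 : ℝ) ≤ n := by exact_mod_cast hn
  have hD : (((n : ℝ) / 2) • (1 : Matrix (Fin (n + 1)) (Fin (n + 1)) ℂ) - J3 n).PosSemidef := by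
    have e : ((n : ℝ) / 2) • (1 : Matrix (Fin (n + 1)) (Fin (n + 1)) ℂ) - J3 n =
        Matrix.diagonal fun r => (((n : ℝ) / 2 - wt n r : ℝ) : ℂ) := by
      rw [J3, ← Complex.coe_smul, Matrix.smul_one_eq_diagonal, Matrix.diagonal_sub]
      congr 1
      ext r; simp
    rw [e]
    refine Matrix.PosSemidef.diagonal fun r => Complex.zero_le_real.mpr ?_
    have := (abs_le.mp (abs_wt_le n r)).2
    linarith
  have hv : 0 ≤ vectorCoeff n k := div_nonneg hk (by positivity)
  have h := (hD.mul_mul_conjTranspose_same (rot n θ)).smul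
    (show (0 : ℝ) ≤ 1 / 2 * vectorCoeff n k by positivity)
  convert h using 1
  rw [Matrix.mul_sub, Matrix.sub_mul, Matrix.mul_smul, Matrix.smul_mul, Matrix.mul_one,
    rot_mul_conjTranspose]
  have e : ((n : ℝ) / 2 + wt n k + 1) / ((n : ℝ) + 2) / (n + 1) =
      1 / 2 * ((n : ℝ) + 1)⁻¹ + 1 / 2 * vectorCoeff n k * (n / 2) := by
    rw [vectorCoeff]
    field_simp
    ring
  rw [e, Complex.coe_smul]
  module

/-- The worst case is at most the mean over the design, here serving as a prior on the true
parameter. -/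
theorem globalFidelity_le (n : ℕ) (k : Fin (n + 1)) (hn : 1 ≤ n) (hk : 0 ≤ wt n k)
    (M : POVM Param (Fin (n + 1))) :
    globalFidelity n (dicke n k) (dicke_posSemidef n k) M ≤
      ((n : ℝ) / 2 + wt n k + 1) / ((n : ℝ) + 2) := by
  obtain ⟨κ, _, w, θ, hw, hw1, hdes⟩ := exists_design n hn k
  have h := sum_integral_outcomeLaw_le M w
    (fun i => model_posSemidef n (dicke_posSemidef n k) (θ i)) (g := fun i θ' => fidelity (θ i) θ')
    (fun i => (continuous_fidelity (θ i)).comp continuous_subtype_val)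
    (c := ((n : ℝ) / 2 + wt n k + 1) / ((n : ℝ) + 2) / (n + 1)) (fun θ' => by
      have e : ∀ i, fidelity (θ i) θ' = fidelity θ' (θ i) := fun i => fidelity_comm _ _
      simp only [e, hdes]
      exact posSemidef_bound n k hn hk θ')
  rw [Fintype.card_fin] at h
  push_cast at h
  rw [div_mul_cancel₀ _ (by positivity)] at h
  refine le_trans ?_ h
  calc globalFidelity n (dicke n k) (dicke_posSemidef n k) M
      = ∑ i, w i * globalFidelity n (dicke n k) (dicke_posSemidef n k) M := by
        rw [← Finset.sum_mul, hw1, one_mul]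
    _ ≤ _ := Finset.sum_le_sum fun i _ =>
        mul_le_mul_of_nonneg_left (globalFidelity_le_integral n _ M (θ i)) (hw i)

theorem fidelity_antipode (θ : EuclideanSpace ℝ (Fin 2)) :
    fidelity (polar 0 0) θ + fidelity (polar Real.pi 0) θ = 1 := by
  obtain ⟨φ, hφ⟩ := exists_polar θ
  rw [hφ, fidelity_polar, fidelity_polar]
  simp
  ring

/-- Fidelities to the two poles add up to `1`, and the rotated `J₃` changes sign between them, so
adding the design identity at both poles leaves the scalar part. -/
theorem sum_design {n : ℕ} {k : Fin (n + 1)} {ι : Type*} [Fintype ι] {w : ι → ℝ} {θ : ι → Param}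
    (h : ∀ θ' : Param, ∑ i, ((w i * fidelity θ' (θ i) : ℝ) : ℂ) • model n (dicke n k) (θ i) =
        (1 / 2 : ℂ) • ((((n : ℝ) + 1)⁻¹ : ℝ) • (1 : Matrix (Fin (n + 1)) (Fin (n + 1)) ℂ) +
          (vectorCoeff n k : ℝ) • (rot n θ' * J3 n * (rot n θ')ᴴ))) :
    ∑ i, (w i : ℂ) • model n (dicke n k) (θ i) = (((n : ℝ) + 1)⁻¹ : ℝ) • 1 := by
  have m0 : polar 0 0 ∈ Metric.closedBall (0 : EuclideanSpace ℝ (Fin 2)) Real.pi := by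
    rw [mem_closedBall_zero_iff, norm_polar le_rfl]; exact Real.pi_pos.le
  have mpi : polar Real.pi 0 ∈ Metric.closedBall (0 : EuclideanSpace ℝ (Fin 2)) Real.pi := by
    rw [mem_closedBall_zero_iff, norm_polar Real.pi_pos.le]
  have h0 := h ⟨_, m0⟩
  have hpi := h ⟨_, mpi⟩
  have hJ : rot n (polar Real.pi 0) * J3 n * (rot n (polar Real.pi 0))ᴴ =
      -(rot n (polar 0 0) * J3 n * (rot n (polar 0 0))ᴴ) := by
    ext r s
    rw [Matrix.neg_apply, rot_conj_J3_apply, rot_conj_J3_apply]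
    simp
  calc ∑ i, (w i : ℂ) • model n (dicke n k) (θ i)
      = ∑ i, ((w i * fidelity (polar 0 0) (θ i) : ℝ) : ℂ) • model n (dicke n k) (θ i) +
        ∑ i, ((w i * fidelity (polar Real.pi 0) (θ i) : ℝ) : ℂ) • model n (dicke n k) (θ i) := by
        rw [← Finset.sum_add_distrib]
        refine Finset.sum_congr rfl fun i _ => ?_
        rw [← add_smul, ← Complex.ofReal_add, ← mul_add, fidelity_antipode, mul_one]
    _ = _ := by
        rw [h0, hpi, hJ]
        module

theorem trace_model_mul_conj_J3 (n : ℕ) (k : Fin (n + 1)) (θ : EuclideanSpace ℝ (Fin 2)) :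
    (model n (dicke n k) θ * (rot n θ * J3 n * (rot n θ)ᴴ)).trace = (wt n k : ℂ) := by
  have e : model n (dicke n k) θ * (rot n θ * J3 n * (rot n θ)ᴴ) =
      rot n θ * (dicke n k * J3 n * (rot n θ)ᴴ) := by
    rw [model]
    calc _ = rot n θ * (dicke n k * ((rot n θ)ᴴ * rot n θ) * J3 n * (rot n θ)ᴴ) := by
          simp only [Matrix.mul_assoc]
      _ = _ := by rw [rot_conjTranspose_mul, Matrix.mul_one]
  rw [e, Matrix.trace_mul_comm, Matrix.mul_assoc, rot_conjTranspose_mul, Matrix.mul_one,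
    Matrix.trace_mul_comm, trace_mul_dicke, J3, Matrix.diagonal_apply_eq]

theorem trace_model (n : ℕ) (k : Fin (n + 1)) (θ : EuclideanSpace ℝ (Fin 2)) :
    (model n (dicke n k) θ).trace = 1 := by
  rw [model, Matrix.trace_mul_comm, ← Matrix.mul_assoc, rot_conjTranspose_mul, Matrix.one_mul,
    trace_dicke]

/-- The effects are rotated highest-weight states placed on the design, weighted to resolve the
identity. The score is then the same at every parameter, so the infimum is over a constant. -/
theorem exists_globalFidelity_eq (n : ℕ) (k : Fin (n + 1)) (hn : 1 ≤ n) :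
    ∃ M, globalFidelity n (dicke n k) (dicke_posSemidef n k) M =
      ((n : ℝ) / 2 + wt n k + 1) / ((n : ℝ) + 2) := by
  have hn' : (1 : ℝ) ≤ n := by exact_mod_cast hn
  obtain ⟨κ, _, w, θ, hw, hw1, hdes⟩ := exists_design n hn (Fin.last n)
  have hsum := sum_design hdes
  have hvc : vectorCoeff n (Fin.last n) = (((n : ℝ) / 2 + 1) * (n + 1))⁻¹ := by
    have : wt n (Fin.last n) = n / 2 := by rw [wt, Fin.val_last]; ring
    rw [vectorCoeff, this]
    field_simp
  let A : κ → Matrix (Fin (n + 1)) (Fin (n + 1)) ℂ := fun i =>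
    (((n : ℝ) + 1) * w i) • model n (dicke n (Fin.last n)) (θ i)
  have hA : ∀ i, (A i).PosSemidef := fun i =>
    (model_posSemidef n (dicke_posSemidef n _) (θ i)).smul (mul_nonneg (by positivity) (hw i))
  have hA1 : ∑ i, A i = 1 := by
    simp only [A, mul_smul]
    simp only [Complex.coe_smul] at hsum
    rw [← Finset.smul_sum, hsum, smul_smul, mul_inv_cancel₀ (by positivity), one_smul]
  refine ⟨discretePOVM θ A hA hA1, ?_⟩
  have hint : ∀ θ₀ : Param, ∫ θ' : Param, fidelity θ₀ θ' ∂(outcomeLaw (discretePOVM θ A hA hA1)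
      (model n (dicke n k) θ₀) (model_posSemidef n (dicke_posSemidef n k) θ₀)) =
      ((n : ℝ) / 2 + wt n k + 1) / ((n : ℝ) + 2) := by
    intro θ₀
    rw [integral_outcomeLaw_discretePOVM θ hA hA1 _ fun θ' => fidelity θ₀ θ']
    have h1 := congrArg (fun B => ((n : ℝ) + 1) * (model n (dicke n k) θ₀ * B).trace.re) (hdes θ₀)
    simp only [Matrix.trace_sum, Matrix.mul_smul, Matrix.trace_smul,
      Matrix.mul_add, Matrix.trace_add, Matrix.mul_one, trace_model, trace_model_mul_conj_J3,
      Complex.re_sum, smul_eq_mul, Complex.re_ofReal_mul, Finset.mul_sum] at h1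
    calc _ = ∑ i, ((n : ℝ) + 1) * (w i * fidelity θ₀ (θ i) *
          (model n (dicke n k) θ₀ * model n (dicke n (Fin.last n)) (θ i)).trace.re) := by
          refine Finset.sum_congr rfl fun i _ => ?_
          simp only [A]
          rw [Matrix.mul_smul, Matrix.trace_smul, Complex.smul_re, smul_eq_mul]
          ring
      _ = _ := h1
      _ = _ := by
          rw [hvc]
          have e : (1 / 2 : ℂ) * (((n : ℝ) + 1)⁻¹ • (1 : ℂ) +
              (((n : ℝ) / 2 + 1) * (n + 1))⁻¹ • (wt n k : ℂ)) =
              ((1 / 2 * (((n : ℝ) + 1)⁻¹ + (((n : ℝ) / 2 + 1) * (n + 1))⁻¹ * wt n k) : ℝ) : ℂ) := by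
            simp only [Complex.real_smul]
            push_cast; ring
          rw [e, Complex.ofReal_re]
          field_simp
          ring
  rw [globalFidelity]
  simp_rw [hint]
  exact ciInf_const

theorem isGreatest_globalFidelity (n : ℕ) (k : Fin (n + 1)) (hn : 1 ≤ n) (hk : 0 ≤ wt n k) :
    IsGreatest (Set.range (globalFidelity n (dicke n k) (dicke_posSemidef n k)))
      (((n : ℝ) / 2 + wt n k + 1) / ((n : ℝ) + 2)) := by
  refine ⟨exists_globalFidelity_eq n k hn, ?_⟩
  rintro _ ⟨M, rfl⟩
  exact globalFidelity_le n k hn hk M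

theorem optimalFidelity_eq (n : ℕ) (k : Fin (n + 1)) (hn : 1 ≤ n) (hk : 0 ≤ wt n k) :
    optimalFidelity n k = ((n : ℝ) / 2 + wt n k + 1) / ((n : ℝ) + 2) :=
  (isGreatest_globalFidelity n k hn hk).csSup_eq

/-! ### Asymptotics -/

theorem abs_optimalFidelity_sub_lt {ε : ℝ} (hε : 0 < ε) : ∃ N : ℕ, ∀ n : ℕ, N ≤ n →
    ∀ k : Fin (n + 1), 0 ≤ wt n k → |optimalFidelity n k - (1 / 2 + wt n k / (n : ℝ))| < ε := by
  obtain ⟨N, hN⟩ := exists_nat_gt (1 / ε)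
  refine ⟨N + 1, fun n hn k hk => ?_⟩
  have hn1 : (1 : ℝ) ≤ n := by exact_mod_cast (by omega : 1 ≤ n)
  have hNn : (N : ℝ) ≤ n := by exact_mod_cast (by omega : N ≤ n)
  rw [optimalFidelity_eq n k (by omega) hk]
  have e : ((n : ℝ) / 2 + wt n k + 1) / ((n : ℝ) + 2) - (1 / 2 + wt n k / n) =
      -(2 * wt n k / (n * (n + 2))) := by
    field_simp
    ring
  have hw := (abs_le.mp (abs_wt_le n k)).2
  rw [e, abs_neg, abs_of_nonneg (by positivity)]
  have h1 : 1 < ε * n := by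
    rw [div_lt_iff₀ hε] at hN
    nlinarith
  rw [div_lt_iff₀ (by positivity)]
  nlinarith

theorem exists_le_globalError {c : ℝ} (hc : c < 1 / 2) : ∃ δ : ℝ, 0 < δ ∧
    ∀ (n : ℕ) (k : Fin (n + 1)), 1 ≤ n → 0 ≤ wt n k → wt n k ≤ c * (n : ℝ) →
      ∀ M : POVM Param (Fin (n + 1)),
        δ ≤ globalError n (dicke n k) (dicke_posSemidef n k) M := by
  refine ⟨2 - 4 * c, by linarith, fun n k hn hk hkc M => ?_⟩
  have hn1 : (1 : ℝ) ≤ n := by exact_mod_cast hn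
  -- Needed to replace `a/(n+2)` by `c`: this uses `cn ≤ c(n+2)`.
  have hc0 : 0 ≤ c := by
    by_contra h
    nlinarith
  have h := globalFidelity_le n k hn hk M
  have h2 : ((n : ℝ) / 2 + wt n k + 1) / ((n : ℝ) + 2) ≤ 1 / 2 + c := by
    rw [div_le_iff₀ (by positivity)]
    nlinarith
  rw [globalError]
  linarith

theorem tendsto_trace_inv_sldFisher {α : ℝ} {k : (n : ℕ) → Fin (n + 1)}
    {F : ℕ → Matrix (Fin 2) (Fin 2) ℝ} (hα : |α| < 1 / 2)
    (hk : Tendsto (fun n : ℕ => wt n (k n) / (n : ℝ)) atTop (𝓝 α))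
    (hF : ∀ n, IsSLDFisher (model n (dicke n (k n))) 0 (F n)) :
    Tendsto (fun n : ℕ => (n : ℝ) ^ 2 * ((F n)⁻¹).trace) atTop (𝓝 ((1 / 4 - α ^ 2)⁻¹)) := by
  have hα2 : 0 < 1 / 4 - α ^ 2 := by
    have := abs_lt.mp hα
    nlinarith
  have hlim : Tendsto (fun n : ℕ => (1 / 4 + 1 / 2 * (1 / (n : ℝ)) - (wt n (k n) / n) ^ 2)⁻¹) atTop
      (𝓝 ((1 / 4 - α ^ 2)⁻¹)) := by
    have h0 : Tendsto (fun n : ℕ => 1 / (n : ℝ)) atTop (𝓝 0) := tendsto_one_div_atTop_nhds_zero_nat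
    have h1 := ((tendsto_const_nhds (x := (1 / 4 : ℝ))).add (h0.const_mul (1 / 2))).sub (hk.pow 2)
    rw [mul_zero, add_zero] at h1
    exact h1.inv₀ hα2.ne'
  refine hlim.congr' ?_
  filter_upwards [eventually_ge_atTop 1] with n hn
  have hn1 : (1 : ℝ) ≤ n := by exact_mod_cast hn
  have hv := transverseVar_pos n (k n) hn
  have h4 : 4 * transverseVar n (k n) ≠ 0 := by positivity
  have hinv : (F n)⁻¹ = Matrix.diagonal fun _ => (4 * transverseVar n (k n))⁻¹ := by
    apply Matrix.inv_eq_right_inv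
    rw [(isSLDFisher_dicke_iff n (k n) (F n)).mp (hF n), Matrix.diagonal_mul_diagonal,
      ← Matrix.diagonal_one]
    congr 1
    ext i
    exact mul_inv_cancel₀ h4
  rw [hinv, Matrix.trace_diagonal, Fin.sum_univ_two]
  have e2 : 1 / 4 + 1 / 2 * (1 / (n : ℝ)) - (wt n (k n) / n) ^ 2 =
      2 * transverseVar n (k n) / n ^ 2 := by
    rw [transverseVar]
    field_simp
    ring
  rw [e2]
  field_simp
  norm_num

end

end SpinEstimation

/-! ### The main theorem -/

open SpinEstimation in
theorem mainTheorem2 :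
    -- the probe state `|n/2; a⟩` with `a = wt n k`, for fixed `n`
    (∀ (n : ℕ) (k : Fin (n + 1)), 1 ≤ n →
      (BFY n (dicke n k) ↔ 0 ≤ wt n k) ∧
      (0 ≤ wt n k →
        IsGreatest (Set.range (globalFidelity n (dicke n k) (dicke_posSemidef n k)))
          (((n : ℝ) / 2 + wt n k + 1) / ((n : ℝ) + 2)) ∧
        optimalFidelity n k = ((n : ℝ) / 2 + wt n k + 1) / ((n : ℝ) + 2)) ∧
      (∀ F : Matrix (Fin 2) (Fin 2) ℝ, IsSLDFisher (model n (dicke n k)) 0 F ↔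
        F = Matrix.diagonal fun _ =>
          2 * (((n : ℝ) / 2) ^ 2 - (wt n k) ^ 2) + 2 * ((n : ℝ) / 2))) ∧
    -- the optimal fidelity tends to `1/2 + a/n`, uniformly in `a ≥ 0`
    (∀ ε : ℝ, 0 < ε → ∃ N : ℕ, ∀ n : ℕ, N ≤ n → ∀ k : Fin (n + 1), 0 ≤ wt n k →
      |optimalFidelity n k - (1 / 2 + wt n k / (n : ℝ))| < ε) ∧
    -- the global error of every estimator is bounded below by a positive constant
    (∀ c : ℝ, c < 1 / 2 → ∃ δ : ℝ, 0 < δ ∧ ∀ (n : ℕ) (k : Fin (n + 1)), 1 ≤ n →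
      0 ≤ wt n k → wt n k ≤ c * (n : ℝ) → ∀ M : POVM Param (Fin (n + 1)),
        δ ≤ globalError n (dicke n k) (dicke_posSemidef n k) M) ∧
    -- the local mean square error is `O(1/n²)`
    (∀ c : ℝ, c < 1 / 2 → ∃ K : ℝ, ∀ (n : ℕ) (k : Fin (n + 1)), 1 ≤ n →
      |wt n k| ≤ c * (n : ℝ) →
        tightCR (model n (dicke n k)) 0 1 ≤ ENNReal.ofReal (K / (n : ℝ) ^ 2)) ∧
    -- the asymptotics of the SLD bound when `a/n → α`
    (∀ (α : ℝ) (k : (n : ℕ) → Fin (n + 1)) (F : ℕ → Matrix (Fin 2) (Fin 2) ℝ), |α| < 1 / 2 →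
      Filter.Tendsto (fun n : ℕ => wt n (k n) / (n : ℝ)) Filter.atTop (nhds α) →
      (∀ n, IsSLDFisher (model n (dicke n (k n))) 0 (F n)) →
      Filter.Tendsto (fun n : ℕ => (n : ℝ) ^ 2 * ((F n)⁻¹).trace) Filter.atTop
        (nhds ((1 / 4 - α ^ 2)⁻¹))) ∧
    -- the half-Dicke state `a = 0`
    (∀ (n : ℕ) (k : Fin (n + 1)), 1 ≤ n → wt n k = 0 →
      (∀ F : Matrix (Fin 2) (Fin 2) ℝ, IsSLDFisher (model n (dicke n k)) 0 F ↔
        F = Matrix.diagonal fun _ => (n : ℝ) * ((n : ℝ) + 2) / 2) ∧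
      IsGreatest (Set.range (globalFidelity n (dicke n k) (dicke_posSemidef n k))) (1 / 2) ∧
      IsLeast (Set.range (globalError n (dicke n k) (dicke_posSemidef n k))) 2) ∧
    (∃ K : ℝ, ∀ (n : ℕ) (k : Fin (n + 1)), 1 ≤ n → wt n k = 0 →
      tightCR (model n (dicke n k)) 0 1 ≤ ENNReal.ofReal (K / (n : ℝ) ^ 2)) := by
  have hSLD : ∀ (n : ℕ) (k : Fin (n + 1)) (F : Matrix (Fin 2) (Fin 2) ℝ),
      IsSLDFisher (model n (dicke n k)) 0 F ↔ F = Matrix.diagonal fun _ =>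
        2 * (((n : ℝ) / 2) ^ 2 - (wt n k) ^ 2) + 2 * ((n : ℝ) / 2) := by
    intro n k F
    rw [isSLDFisher_dicke_iff, transverseVar]
    ring_nf
  refine ⟨fun n k hn => ⟨BFY_dicke_iff n k hn, fun hk => ⟨isGreatest_globalFidelity n k hn hk,
    optimalFidelity_eq n k hn hk⟩, hSLD n k⟩, fun ε hε => abs_optimalFidelity_sub_lt hε,
    fun c hc => exists_le_globalError hc,
    fun c hc => ⟨_, fun n k hn hk => tightCR_dicke_le_div_sq hc n k hn hk⟩,
    fun α k F hα hk hF => tendsto_trace_inv_sldFisher hα hk hF, fun n k hn hk => ?_,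
    -- With `a = 0` the constant `c = 0` is admissible.
    ⟨_, fun n k hn hk => tightCR_dicke_le_div_sq (c := 0) (by norm_num) n k hn (by simp [hk])⟩⟩
  have hhalf : ((n : ℝ) / 2 + wt n k + 1) / ((n : ℝ) + 2) = 1 / 2 := by
    rw [hk]
    field_simp
    ring
  have hG := isGreatest_globalFidelity n k hn hk.ge
  rw [hhalf] at hG
  refine ⟨fun F => ?_, hG, ?_, ?_⟩
  · rw [hSLD, hk]
    ring_nf
  · obtain ⟨M, hM⟩ := hG.1
    exact ⟨M, by rw [globalError, hM]; norm_num⟩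
  · rintro _ ⟨M, rfl⟩
    have := hG.2 ⟨M, rfl⟩
    rw [globalError]
    linarith
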